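/- Let $p\in\mathbb Z[x]$ satisfy $p(0)=0$ and $\deg p>1$. For a Borel probability measure $\rho$ on $\mathbb T=\mathbb R/\mathbb Z$ whose Fourier coefficients $\phi(n)=\int_{\mathbb T}e^{2\pi i n x}\,d\rho(x)$ satisfy $\phi(n)=\phi(-n)$ for all $n\in\mathbb Z$, the Gaussian system associated with $\rho$ is $(\mathbb R^{\mathbb Z},\mathcal A,\gamma,T)$, where $\mathcal A$ is the Borel $\sigma$-algebra, $T(\omega)(n)=\omega(n+1)$, and $\gamma$ is the ($T$-invariant) probability measure under which the coordinate projections $X_n(\omega)=\omega(n)$ form a centered Gaussian process with $\int X_mX_n\,d\gamma=\phi(m-n)$ for all $m,n\in\mathbb Z$. There exists a Gaussian system $(\mathbb R^{\mathbb Z},\mathcal A,\gamma,T)$ that is both - weakly mixing: the operator $f\mapsto f\circ T$ on the complex space $L^2(\gamma)$ has no eigenvectors other than constants; and - rigid: for each $f\in L^2(\gamma)$ there is an increasing sequence $(n_k)_{k\in\mathbb N}$ of natural numbers with $\lim_{k\to\infty}f\circ T^{n_k}=f$ in the $L^2$-norm; and a set $A\in\mathcal A$ with $\gamma(A)=\frac12$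 such that the following hold. 1. There is a family of finite sequences $((n_{t,s})_{s=1}^{t})_{t\in\mathbb N}$ of positive integers such that for any $\epsilon>0$ there exists $t_\epsilon\in\mathbb N$ with the property that for any $t\ge t_\epsilon$, any $\ell\ge 1$, any $s_1<\cdots<s_\ell$ in $\{1,\dots,t\}$ and any $\xi_1,\dots,\xi_\ell\in\{-1,1\}$, $$\gamma\Bigl(A\cap T^{-p(\sum_{j=1}^{\ell}\xi_jn_{t,s_j})}A\Bigr)<\frac16+\epsilon .$$ 2. There are $\delta>0$ and a set $\Gamma\subseteq\mathbb N$ such that for any $n\in\Gamma$, $$\gamma(A\cap T^{-p(n)}A)<\gamma(A)^2-\delta ,$$ where $\Gamma$ is an IP$_0$ set: for every $r\in\mathbb N$ there are positive integers $n_1<\cdots<n_r$ with $\sum_{j\in F}n_j\in\Gamma$ for every non-empty $F\subseteq\{1,\dots,r\}$. -/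

import Mathlib

open MeasureTheory ProbabilityTheory Filter Topology
open scoped ENNReal

noncomputable section

/-- The unitary operator `f ↦ f ∘ T` on the complex space `L²(μ)` induced by a
measure-preserving transformation `T`. -/
def koopman {X : Type*} [MeasurableSpace X] {μ : Measure X} {T : X → X}
    (hT : MeasurePreserving T μ μ) : Lp ℂ 2 μ →ₗᵢ[ℂ] Lp ℂ 2 μ :=
  Lp.compMeasurePreservingₗᵢ ℂ T hT

/-- `T` is weakly mixing: its operator on `L²(μ)` has no eigenvectors other than the constants. -/
def IsWeaklyMixing {X : Type*} [MeasurableSpace X] {μ : Measure X} [IsProbabilityMeasure μ]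
    {T : X → X} (hT : MeasurePreserving T μ μ) : Prop :=
  ∀ (z : ℂ) (f : Lp ℂ 2 μ),
    Module.End.HasEigenvector (koopman hT).toLinearMap z f → ∃ c : ℂ, f = Lp.const 2 μ c

/-- `T` is rigid: for each `f ∈ L²(μ)` there is an increasing sequence `n₀ < n₁ < ⋯` of natural
numbers with `T ^ nₖ f → f` in the norm of `L²(μ)`. -/
def IsRigid {X : Type*} [MeasurableSpace X] {μ : Measure X}
    {T : X → X} (hT : MeasurePreserving T μ μ) : Prop :=
  ∀ f : Lp ℂ 2 μ, ∃ n : ℕ → ℕ, StrictMono n ∧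
    Tendsto (fun k => (koopman hT ^ n k) f) atTop (𝓝 f)

/-- The shift `T(ω)(n) = ω(n + 1)` on the space of two-sided real sequences, as an invertible
measurable map (the inverse is also measurable). -/
def seqShift : (ℤ → ℝ) ≃ᵐ (ℤ → ℝ) where
  toFun ω n := ω (n + 1)
  invFun ω n := ω (n - 1)
  left_inv ω := by ext n; simp
  right_inv ω := by ext n; simp
  measurable_toFun := measurable_pi_lambda _ fun n => measurable_pi_apply (n + 1)
  measurable_invFun := measurable_pi_lambda _ fun n => measurable_pi_apply (n - 1)

/-- The preimage `T ^ (-m) A` for an arbitrary integer `m` (so for `m < 0` it is the image of `A`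
under `T ^ |m|`). -/
def zpowPreimage {X : Type*} (T : Equiv.Perm X) (m : ℤ) (A : Set X) : Set X :=
  ⇑(T ^ m) ⁻¹' A

/-- The Fourier coefficients `φ(n) = ∫ e^{2 π i n x} dρ(x)` of a Borel measure on `ℝ / ℤ`. -/
def fourierTransform (ρ : Measure UnitAddCircle) (n : ℤ) : ℂ :=
  ∫ x : UnitAddCircle, fourier n x ∂ρ

/-- `γ` is the measure of the Gaussian system associated with the Borel probability measure `ρ` on
`ℝ / ℤ`: the Fourier coefficients `φ` of `ρ` are symmetric, and under `γ` the coordinate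
projections form a (real) Gaussian process with mean zero and covariance `φ(m - n)`. -/
structure IsGaussianSystem (ρ : Measure UnitAddCircle) (γ : Measure (ℤ → ℝ)) : Prop where
  isProbabilityMeasure_spectral : IsProbabilityMeasure ρ
  symm : ∀ n : ℤ, fourierTransform ρ n = fourierTransform ρ (-n)
  isGaussianProcess : IsGaussianProcess (fun (n : ℤ) (ω : ℤ → ℝ) => ω n) γ
  mean : ∀ n : ℤ, ∫ ω, ω n ∂γ = 0
  covariance : ∀ m n : ℤ, ((∫ ω, ω m * ω n ∂γ : ℝ) : ℂ) = fourierTransform ρ (m - n)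

/-- `E` is an IP_r set: it contains all sums over non-empty subsets of some set of `r` distinct
positive integers `n₁ < ⋯ < n_r`. -/
def IsIPr (r : ℕ) (E : Set ℕ) : Prop :=
  ∃ n : Fin r → ℕ, StrictMono n ∧ (∀ i, 0 < n i) ∧
    ∀ F : Finset (Fin r), F.Nonempty → ∑ i ∈ F, n i ∈ E

/-- `E` is an IP_0 set: it is an IP_r set for every positive integer `r`. -/
def IsIP0 (E : Set ℕ) : Prop :=
  ∀ r : ℕ, 0 < r → IsIPr r E

end

/-!
The set is the half-space `A = {ω | 0 < ω 0}`. Under a Gaussian measure with covariance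
`r (m - n)` and `r 0 = 1`, the measure of `A ∩ T⁻ᵐ A` is the probability that two standard Gaussian
variables with correlation `r m` are both positive. For correlation `-1/2` this probability is
`1/6`: the variables are two of three exchangeable ones with sum zero, and the six sign patterns of
such a triple are equally likely (`pairLaw_neg_half_quadrant_le`). It depends continuously on the
correlation, so everything reduces to a symmetric measure on the circle whose Fourier coefficients
are close to `-1/2` at the integers `p (∑ ξ n)`.

The measure is the law of a random frequency, a sum of independent small rational random variables
`X t` on scales `R t` that form a divisibility chain (`FrequencyData`). An integer which is
divisible by `R t` and bounded by `R (t + 1)` sees only the summand `X t`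
(`FrequencyData.nearInt_mul_freq`). The summand is designed so that `p (∑ η i n i) X t` is close,
modulo `1`, to half of the value of `x² + xy + y²` at the point `∑ η i u i` of `𝔽₂²`, where the
`u i` are independent uniform points (`exists_quadratic_phases`). As long as some `η i` is odd, this
point is uniform, and the form is even at one point out of four and odd at the three others. So the
expectation of `cos (2 π p (∑ η i n i) X t)` is close to `(1 - 3) / 4 = -1/2` (`sum_cos_normForm`),
for all choices of `η i ∈ {-1, 0, 1}` at once.
A quadratic form is what a polynomial of degree at least two can produce: when a large integer `n`
is added to a sum `N`, the leading term of `p (N + n)` gives the diagonal term of the form, and the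
next one, whose coefficient is affine in `N`, gives the cross terms (`eval_mul_increment`). The
cross terms are encoded by two auxiliary linear phases, which are constructed along with the
quadratic one.

Each summand also contains a uniform bit, read off by the integer `m t`, so that the covariances
vanish along all translates of `m t`; and `R t` times the frequency tends to `0` modulo `1`, so that
the covariances return along `R t`. Since the characters `exp (i ∑ aₙ ωₙ)` span a dense
subspace of `L²` (`span_charLp_dense`) and their correlations are exponentials of covariances, the
first fact gives weak mixing (`isWeaklyMixing_of_tendsto_covariance`) and the second one rigidity
(`isRigid_of_tendsto_covariance`).
-/

/-! ### Real numbers close to integers, and increments of polynomials -/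

/-- `x` is at distance at most `ε` from an integer. -/
def NearInt (ε x : ℝ) : Prop := ∃ m : ℤ, |x - m| ≤ ε

lemma NearInt.mono {ε δ x : ℝ} (h : NearInt ε x) (hεδ : ε ≤ δ) : NearInt δ x :=
  let ⟨m, hm⟩ := h; ⟨m, hm.trans hεδ⟩

lemma NearInt.add {ε δ x y : ℝ} (hx : NearInt ε x) (hy : NearInt δ y) :
    NearInt (ε + δ) (x + y) := by
  obtain ⟨m, hm⟩ := hx
  obtain ⟨k, hk⟩ := hy
  refine ⟨m + k, ?_⟩
  have := abs_add_le (x - m) (y - k)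
  push_cast
  rw [show x + y - (m + k) = (x - m) + (y - k) by ring]
  linarith

lemma NearInt.int_mul {ε x : ℝ} (hx : NearInt ε x) (k : ℤ) : NearInt (|(k : ℝ)| * ε) (k * x) := by
  obtain ⟨m, hm⟩ := hx
  refine ⟨k * m, ?_⟩
  push_cast
  rw [← mul_sub, abs_mul]
  gcongr

lemma nearInt_int (m : ℤ) : NearInt 0 (m : ℝ) := ⟨m, by simp⟩

lemma nearInt_of_abs_le {ε x : ℝ} (h : |x| ≤ ε) : NearInt ε x := ⟨0, by simpa using h⟩

/-- The integer `x² + xy + y²`, whose parity is the anisotropic quadratic form on `𝔽₂²`: it is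
even at the origin and odd at the three other points. -/
def normForm (a b : ℤ) : ℤ := a ^ 2 + a * b + b ^ 2

/-- Separation of the two leading terms of a polynomial of degree at most `e + 2`, with a bound on
the remaining ones. -/
lemma eval_eq_top_two_add (P : Polynomial ℤ) (e : ℕ) (hP : P.natDegree ≤ e + 2) (m : ℤ) :
    ∃ R : ℤ, P.eval m = P.coeff (e + 2) * m ^ (e + 2) + P.coeff (e + 1) * m ^ (e + 1) + R ∧
      ∀ n : ℝ, 1 ≤ n → |(m : ℝ)| ≤ n →
        |(R : ℝ)| ≤ (∑ k ∈ Finset.range (e + 2), |(P.coeff k : ℝ)|) * n ^ e := by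
  refine ⟨∑ k ∈ Finset.range (e + 1), P.coeff k * m ^ k, ?_, ?_⟩
  · rw [Polynomial.eval_eq_sum_range' (show P.natDegree < e + 3 by omega),
      Finset.sum_range_succ, Finset.sum_range_succ]
    ring
  · intro n hn hm
    push_cast
    refine (Finset.abs_sum_le_sum_abs _ _).trans ?_
    rw [Finset.sum_range_succ _ (e + 1), add_mul, Finset.sum_mul]
    refine le_add_of_le_of_nonneg (Finset.sum_le_sum fun k hk => ?_) (by positivity)
    rw [abs_mul, abs_pow]
    gcongr
    calc |(m : ℝ)| ^ k ≤ n ^ k := by gcongr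
      _ ≤ n ^ e := pow_le_pow_right₀ hn (by simpa [Nat.lt_succ_iff] using hk)

lemma taylor_coeff_pred (p : Polynomial ℤ) (e : ℕ) (hp : p.natDegree ≤ e + 2) (N : ℤ) :
    (Polynomial.taylor N p).coeff (e + 1) =
      p.coeff (e + 1) + (e + 2) * p.coeff (e + 2) * N := by
  rw [Polynomial.taylor_coeff, Polynomial.eval_eq_sum_range' (n := 2)]
  · simp [Finset.sum_range_succ, Polynomial.hasseDeriv_coeff]
    rw [show 1 + (e + 1) = (e + 1) + 1 by ring, Nat.choose_succ_self_right]
    push_cast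
    left
    ring
  · have := Polynomial.natDegree_hasseDeriv_le p (e + 1)
    omega

lemma taylor_coeff_top (p : Polynomial ℤ) (d : ℕ) (hp : p.natDegree ≤ d) (N : ℤ) :
    (Polynomial.taylor N p).coeff d = p.coeff d := by
  rw [Polynomial.taylor_coeff, Polynomial.eval_eq_sum_range' (n := 1)]
  · simp [Polynomial.hasseDeriv_coeff]
  · have := Polynomial.natDegree_hasseDeriv_le p d
    omega

/-- The value `p (N + η n)` against the two phases `q / (2 c n ^ (e + 2))` and `v / n ^ (e + 1)`,
where `c` is the leading coefficient. Expanding `p` at `N`, the first phase pairs with the leading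
term, the second one with the coefficient `c' + (e + 2) c N` of the next power of `n`; what
remains is an integer, the term `c' v`, and terms of order `1 / n`. -/
lemma eval_mul_increment (p : Polynomial ℤ) (e : ℕ) (hp : p.natDegree ≤ e + 2)
    (hc : p.coeff (e + 2) ≠ 0) (N η q : ℤ) (hη : |η| ≤ 1) (hq : |(q : ℝ)| ≤ 3) (n : ℕ)
    (hn : 1 ≤ n) (v : ℝ) (hv : |v| ≤ 1) (hnv : ∃ z : ℤ, n * v = z) (H : ℝ)
    (hH : ∑ k ∈ Finset.range (e + 2), |((Polynomial.taylor N p).coeff k : ℝ)| ≤ H) :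
    NearInt (|(p.coeff (e + 1) : ℝ) * v| + 4 * H / n)
      (((p.eval (N + η * n) : ℤ) : ℝ) *
          (q / (2 * p.coeff (e + 2) * (n : ℝ) ^ (e + 2)) + v / (n : ℝ) ^ (e + 1))
        - (η : ℝ) ^ (e + 2) * q / 2
        - (η : ℝ) ^ (e + 1) * ((e + 2) * p.coeff (e + 2) * N * v)) := by
  obtain ⟨z, hz⟩ := hnv
  set P := Polynomial.taylor N p with hPdef
  obtain ⟨R, hR, hRb⟩ := eval_eq_top_two_add P e (by rwa [Polynomial.natDegree_taylor]) (η * n)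
  rw [hPdef, Polynomial.taylor_eval, add_comm (η * (n : ℤ)) N, taylor_coeff_top p _ hp] at hR
  have hn0 : (1 : ℝ) ≤ n := by exact_mod_cast hn
  have hnpos : (0 : ℝ) < n := by linarith
  have hη' : |(η : ℝ)| ≤ 1 := by exact_mod_cast hη
  have hRb' : |(R : ℝ)| ≤ H * (n : ℝ) ^ e := by
    refine (hRb n hn0 ?_).trans (by gcongr)
    push_cast
    rw [abs_mul, Nat.abs_cast]
    nlinarith
  have hH0 : 0 ≤ H := le_trans (by positivity) hH
  have hh : |(P.coeff (e + 1) : ℝ)| ≤ H :=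
    le_trans (Finset.single_le_sum (f := fun k => |(P.coeff k : ℝ)|)
      (fun i _ => abs_nonneg _) (by simp)) hH
  set c : ℤ := p.coeff (e + 2) with hcdef
  have hcR : (c : ℝ) ≠ 0 := by exact_mod_cast hc
  have hc1 : (1 : ℝ) ≤ |(c : ℝ)| := by exact_mod_cast Int.one_le_abs hc
  have hPc : (P.coeff (e + 1) : ℝ) = p.coeff (e + 1) + (e + 2) * c * N := by
    rw [hPdef, taylor_coeff_pred p e hp]; push_cast; rfl
  have hηe : |(η : ℝ) ^ (e + 1)| ≤ 1 := by
    rw [abs_pow]; exact pow_le_one₀ (abs_nonneg _) hη'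
  refine ⟨c * η ^ (e + 2) * z, ?_⟩
  have key : ((p.eval (N + η * n) : ℤ) : ℝ) *
          (q / (2 * c * (n : ℝ) ^ (e + 2)) + v / (n : ℝ) ^ (e + 1))
        - (η : ℝ) ^ (e + 2) * q / 2 - (η : ℝ) ^ (e + 1) * ((e + 2) * c * N * v)
        - ((c * η ^ (e + 2) * z : ℤ) : ℝ)
      = (η : ℝ) ^ (e + 1) * (p.coeff (e + 1) * v)
        + (η : ℝ) ^ (e + 1) * P.coeff (e + 1) * (q / (2 * c)) * (1 / n)
        + R / (n : ℝ) ^ e * (q / (2 * c)) * (1 / n) * (1 / n) + R / (n : ℝ) ^ e * v * (1 / n) := by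
    rw [hR]
    push_cast
    rw [← hz, hPc]
    field_simp
    ring
  rw [key]
  have hqc : |(q : ℝ) / (2 * c)| ≤ 3 / 2 := by
    rw [abs_div, abs_mul, abs_two, div_le_div_iff₀ (by positivity) (by norm_num)]
    nlinarith
  have hRn : |(R : ℝ) / (n : ℝ) ^ e| ≤ H := by
    rw [abs_div, abs_pow, Nat.abs_cast, div_le_iff₀ (by positivity)]
    exact hRb'
  have hn1 : |1 / (n : ℝ)| ≤ 1 := by
    rw [abs_div, abs_one, Nat.abs_cast, div_le_one hnpos]; exact hn0
  have hn2 : |1 / (n : ℝ)| = 1 / n := by rw [abs_div, abs_one, Nat.abs_cast]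
  have h1 : |(η : ℝ) ^ (e + 1) * (p.coeff (e + 1) * v)| ≤ |(p.coeff (e + 1) : ℝ) * v| := by
    rw [abs_mul]; exact mul_le_of_le_one_left (abs_nonneg _) hηe
  have h2 : |(η : ℝ) ^ (e + 1) * P.coeff (e + 1) * (q / (2 * c)) * (1 / n)|
      ≤ 1 * H * (3 / 2) * (1 / n) := by
    rw [abs_mul, abs_mul, abs_mul, hn2]; gcongr
  have h3 : |(R : ℝ) / (n : ℝ) ^ e * (q / (2 * c)) * (1 / n) * (1 / n)|
      ≤ H * (3 / 2) * 1 * (1 / n) := by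
    rw [abs_mul, abs_mul, abs_mul]
    nth_rewrite 2 [hn2]
    gcongr
  have h4 : |(R : ℝ) / (n : ℝ) ^ e * v * (1 / n)| ≤ H * 1 * (1 / n) := by
    rw [abs_mul, abs_mul, hn2]; gcongr
  have h5 : 4 * H / n = 1 * H * (3 / 2) * (1 / n) + H * (3 / 2) * 1 * (1 / n)
      + H * 1 * (1 / n) := by ring
  rw [h5]
  refine (abs_add_le _ _).trans ?_
  have h6 := abs_add_le ((η : ℝ) ^ (e + 1) * (p.coeff (e + 1) * v)
        + (η : ℝ) ^ (e + 1) * P.coeff (e + 1) * (q / (2 * c)) * (1 / n))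
        (R / (n : ℝ) ^ e * (q / (2 * c)) * (1 / n) * (1 / n))
  have h7 := abs_add_le ((η : ℝ) ^ (e + 1) * (p.coeff (e + 1) * v))
    ((η : ℝ) ^ (e + 1) * P.coeff (e + 1) * (q / (2 * c)) * (1 / n))
  linarith

/-! ### Quadratic phases of polynomial values -/

lemma finite_signs (k : ℕ) : {η : Fin k → ℤ | ∀ i, |η i| ≤ 1}.Finite := by
  have : {η : Fin k → ℤ | ∀ i, |η i| ≤ 1} = Set.univ.pi fun _ => Set.Icc (-1) 1 := by
    ext η
    simp only [Set.mem_ofPred_eq, Set.mem_pi, abs_le, Set.mem_Icc, Set.mem_univ, true_imp_iff]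
  rw [this]
  exact Set.Finite.pi fun _ => Set.finite_Icc _ _

/-- A real function is bounded on the finite set of vectors with entries in `{-1, 0, 1}`. -/
lemma exists_signs_bound (k : ℕ) (f : (Fin k → ℤ) → ℝ) :
    ∃ H : ℝ, 0 ≤ H ∧ ∀ η : Fin k → ℤ, (∀ i, |η i| ≤ 1) → f η ≤ H := by
  obtain ⟨H, hH⟩ := ((finite_signs k).image f).bddAbove
  exact ⟨max H 0, le_max_right _ _, fun η hη =>
    (hH ⟨η, hη, rfl⟩).trans (le_max_left _ _)⟩

/-- The increment of the form splits, modulo `2`, into a diagonal term and a bilinear one; the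
exponents of `η` do not matter since `η` and its positive powers have the same parity. -/
lemma normForm_increment_parity (e : ℕ) (η A B α β : ℤ) :
    ∃ j : ℤ, (η : ℝ) ^ (e + 2) * normForm α β / 2 + (η : ℝ) ^ (e + 1) * (A * β + B * α) / 2
      - (normForm (A + η * α) (B + η * β) - normForm A B : ℤ) / 2 = j := by
  have h : Even (η ^ (e + 2) * normForm α β + η ^ (e + 1) * (A * β + B * α)
      - (normForm (A + η * α) (B + η * β) - normForm A B)) := by
    simp only [normForm, Int.even_sub, Int.even_add, Int.even_mul, Int.even_pow]
    by_cases h1 : Even η <;> by_cases h2 : Even A <;> by_cases h3 : Even B <;>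
      by_cases h4 : Even α <;> by_cases h5 : Even β <;> simp [h1, h2, h3, h4, h5]
  obtain ⟨j, hj⟩ := h
  refine ⟨j, ?_⟩
  have : (((η ^ (e + 2) * normForm α β + η ^ (e + 1) * (A * β + B * α)
      - (normForm (A + η * α) (B + η * β) - normForm A B) : ℤ)) : ℝ) = ((j + j : ℤ) : ℝ) := by
    rw [hj]
  push_cast at this ⊢
  linarith

/-- The first coordinate of a point of `𝔽₂²`, as an integer. -/
def coordA (w : Fin 2 × Fin 2) : ℤ := (w.1 : ℕ)

/-- The second coordinate of a point of `𝔽₂²`, as an integer. -/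
def coordB (w : Fin 2 × Fin 2) : ℤ := (w.2 : ℕ)

lemma coordA_cases (w : Fin 2 × Fin 2) : coordA w = 0 ∨ coordA w = 1 := by
  unfold coordA; omega

lemma coordB_cases (w : Fin 2 × Fin 2) : coordB w = 0 ∨ coordB w = 1 := by
  unfold coordB; omega

/-- One of the two linear phases is prolonged by a new integer `n`. -/
lemma linear_phase_increment (K N η A α : ℤ) (hK : K ≠ 0) (hα : α = 0 ∨ α = 1) (n : ℕ)
    (hn : 1 ≤ n) (x ε : ℝ) (hnx : ∃ z : ℤ, n * x = z)
    (h : NearInt ε (K * N * x - (A : ℝ) / 2)) :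
    NearInt (ε + |(N : ℝ)| / n)
      (K * (N + η * n : ℤ) * (x + α / (2 * K * n)) - ((A + η * α : ℤ) : ℝ) / 2) := by
  obtain ⟨z, hz⟩ := hnx
  have hn0 : (0 : ℝ) < n := by exact_mod_cast hn
  have hK0 : (K : ℝ) ≠ 0 := by exact_mod_cast hK
  have h2 : NearInt (|(N : ℝ)| / n) (N * α / (2 * n)) := by
    refine nearInt_of_abs_le ?_
    rcases hα with h | h
    · rw [h]; simp; positivity
    · rw [h]
      simp only [Int.cast_one, mul_one, abs_div, abs_mul, abs_two, Nat.abs_cast]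
      gcongr
      linarith
  have h3 := (h.add h2).add (nearInt_int (η * K * z))
  rw [add_zero] at h3
  convert h3 using 1
  push_cast
  rw [← hz]
  field_simp
  ring

set_option maxHeartbeats 1000000 in
/-- For a polynomial of degree `e + 2 ≥ 2` there are integers `n i` and finitely many small
rational phases `y u`, indexed by tuples `u` of points of `𝔽₂²`, such that modulo `1` the number
`p (∑ η i n i) y u` is close to half of the form `normForm` at `∑ η i u i`. The phases `va`, `vb`
record the two coordinates of `∑ η i u i` through a function which is linear in the integers `n i`;
they produce the cross terms of the form when a further integer is added. -/
theorem exists_quadratic_phases (p : Polynomial ℤ) (e : ℕ) (hp : p.natDegree ≤ e + 2)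
    (hc : p.coeff (e + 2) ≠ 0) (k : ℕ) :
    ∀ D : ℕ, 0 < D → ∀ ε : ℝ, 0 < ε →
    ∃ (n : Fin k → ℕ) (y va vb : (Fin k → Fin 2 × Fin 2) → ℝ) (Q : ℤ),
      StrictMono n ∧ (∀ i, 0 < n i ∧ D ∣ n i) ∧ Q ≠ 0 ∧
      (∀ u, |y u| ≤ ε ∧ |va u| ≤ ε ∧ |vb u| ≤ ε) ∧
      (∀ u, (∃ z : ℤ, Q * y u = z) ∧ (∃ z : ℤ, Q * va u = z) ∧ ∃ z : ℤ, Q * vb u = z) ∧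
      ∀ η : Fin k → ℤ, (∀ i, |η i| ≤ 1) → ∀ u : Fin k → Fin 2 × Fin 2,
        NearInt ε ((p.eval (∑ i, η i * (n i : ℤ)) : ℤ) * y u
          - (normForm (∑ i, η i * coordA (u i)) (∑ i, η i * coordB (u i)) : ℝ) / 2) ∧
        NearInt ε ((((e + 2) * p.coeff (e + 2) : ℤ) : ℝ) * (∑ i, η i * (n i : ℤ) : ℤ) * va u
          - ((∑ i, η i * coordA (u i) : ℤ) : ℝ) / 2) ∧
        NearInt ε ((((e + 2) * p.coeff (e + 2) : ℤ) : ℝ) * (∑ i, η i * (n i : ℤ) : ℤ) * vb u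
          - ((∑ i, η i * coordB (u i) : ℤ) : ℝ) / 2) := by
  set c := p.coeff (e + 2) with hcdef
  set K : ℤ := (e + 2) * c with hKdef
  have hK : K ≠ 0 := mul_ne_zero (by positivity) hc
  have hcR : (c : ℝ) ≠ 0 := by exact_mod_cast hc
  have hKR : (K : ℝ) ≠ 0 := by exact_mod_cast hK
  have hK1 : (1 : ℝ) ≤ |(K : ℝ)| := by exact_mod_cast Int.one_le_abs hK
  have hc1 : (1 : ℝ) ≤ |(c : ℝ)| := by exact_mod_cast Int.one_le_abs hc
  induction k with
  | zero =>
    intro D _ ε hε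
    refine ⟨fun _ => 0, fun _ => 0, fun _ => 0, fun _ => 0, 1, fun i => i.elim0, fun i => i.elim0,
      one_ne_zero, fun u => by simp [hε.le], fun u => ⟨⟨0, by simp⟩, ⟨0, by simp⟩, 0, by simp⟩,
      fun η _ u => ?_⟩
    simp only [Finset.univ_eq_empty, Finset.sum_empty, normForm]
    refine ⟨⟨0, ?_⟩, ⟨0, ?_⟩, ⟨0, ?_⟩⟩ <;> simp [hε.le]
  | succ k ih =>
    intro D hD ε hε
    -- the term `c' v` of the new error is not damped by the new integer, so the accuracy demanded
    -- of the previous step absorbs `c'`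
    set c' : ℤ := p.coeff (e + 1) with hc'def
    set ε' : ℝ := min 1 ε / (6 * (1 + |(c' : ℝ)|)) with hε'def
    have hmin : 0 < min 1 ε := lt_min one_pos hε
    have hε' : 0 < ε' := by positivity
    have hε'2 : (1 + |(c' : ℝ)|) * ε' = min 1 ε / 6 := by rw [hε'def]; field_simp
    have hε'3 : ε' ≤ min 1 ε / 6 := by nlinarith [abs_nonneg (c' : ℝ)]
    have hm1 : min 1 ε ≤ 1 := min_le_left _ _
    have hm2 : min 1 ε ≤ ε := min_le_right _ _
    obtain ⟨n, y, va, vb, Q, hmono, hn, hQ, hsmall, hint, hmain⟩ := ih D hD ε' hε'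
    obtain ⟨H, hH0, hH⟩ := exists_signs_bound k fun η =>
      ∑ j ∈ Finset.range (e + 2),
        |((Polynomial.taylor (∑ i, η i * (n i : ℤ)) p).coeff j : ℝ)|
    obtain ⟨H', hH'0, hH'⟩ := exists_signs_bound k fun η => |((∑ i, η i * (n i : ℤ) : ℤ) : ℝ)|
    obtain ⟨M, hM⟩ := exists_nat_ge ((8 * H + 6 * H' + 6) / ε + 1 + ∑ i, n i)
    -- the new integer clears all denominators seen so far and exceeds all sizes seen so far
    set g : ℤ := Q * 2 * K with hgdef
    have hg : g ≠ 0 := mul_ne_zero (mul_ne_zero hQ two_ne_zero) hK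
    set nn : ℕ := D * g.natAbs * M with hnndef
    have hg1 : 1 ≤ D * g.natAbs := Nat.one_le_iff_ne_zero.2
      (mul_ne_zero hD.ne' (Int.natAbs_ne_zero.2 hg))
    have hnnM : (M : ℝ) ≤ nn := by
      exact_mod_cast Nat.le_mul_of_pos_left M hg1
    have hnn2 : (8 * H + 6 * H' + 6) / ε + 1 + ∑ i, n i ≤ (nn : ℝ) := hM.trans hnnM
    have hquot : 0 ≤ (8 * H + 6 * H' + 6) / ε := by positivity
    have hsumn : (0 : ℝ) ≤ ((∑ i, n i : ℕ) : ℝ) := by positivity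
    have hnn1' : (1 : ℝ) ≤ nn := by push_cast at hsumn; linarith
    have hnn1 : 1 ≤ nn := by exact_mod_cast hnn1'
    have hnn0 : (0 : ℝ) < nn := by linarith
    have hnne : 8 * H + 6 * H' + 6 ≤ ε * nn := by
      have : (8 * H + 6 * H' + 6) / ε ≤ nn := by push_cast at hsumn; linarith
      rwa [div_le_iff₀' hε] at this
    have hngt : ∀ i, n i < nn := by
      intro i
      have h1 : n i ≤ ∑ i, n i := Finset.single_le_sum (fun _ _ => Nat.zero_le _)
        (Finset.mem_univ i)
      have h2 : ((∑ i, n i : ℕ) : ℝ) + 1 ≤ nn := by push_cast at hnn2 ⊢; linarith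
      have h3 : (∑ i, n i) + 1 ≤ nn := by exact_mod_cast h2
      omega
    have hnng : (nn : ℤ) = g * (g.sign * D * M) := by
      rw [hnndef]; push_cast
      rw [← Int.sign_mul_self_eq_abs]; ring
    have hnint : ∀ x : ℝ, (∃ z : ℤ, Q * x = z) → ∃ z : ℤ, (nn : ℝ) * x = z := by
      rintro x ⟨z, hz⟩
      refine ⟨2 * K * (g.sign * D * M) * z, ?_⟩
      have : (nn : ℝ) = ((nn : ℤ) : ℝ) := by simp
      rw [this, hnng, hgdef]
      push_cast
      rw [← hz]; ring
    -- the bilinear phase attached to the new point `w`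
    let v : (Fin (k + 1) → Fin 2 × Fin 2) → ℝ := fun u =>
      coordB (u (Fin.last k)) * va (Fin.init u) + coordA (u (Fin.last k)) * vb (Fin.init u)
    let q : (Fin (k + 1) → Fin 2 × Fin 2) → ℤ := fun u =>
      normForm (coordA (u (Fin.last k))) (coordB (u (Fin.last k)))
    have hv : ∀ u, |v u| ≤ 2 * ε' := by
      intro u
      have h1 := (hsmall (Fin.init u)).2.1
      have h2 := (hsmall (Fin.init u)).2.2
      rw [abs_le] at h1 h2 ⊢
      simp only [v]
      rcases coordA_cases (u (Fin.last k)) with ha | ha <;>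
        rcases coordB_cases (u (Fin.last k)) with hb | hb <;> rw [ha, hb] <;>
        push_cast <;> constructor <;> linarith
    have hq : ∀ u, |(q u : ℝ)| ≤ 3 := by
      intro u
      simp only [q, normForm]
      rcases coordA_cases (u (Fin.last k)) with ha | ha <;>
        rcases coordB_cases (u (Fin.last k)) with hb | hb <;> rw [ha, hb] <;> norm_num
    have hvint : ∀ u, ∃ z : ℤ, (nn : ℝ) * v u = z := by
      intro u
      obtain ⟨z1, hz1⟩ := hnint _ (hint (Fin.init u)).2.1
      obtain ⟨z2, hz2⟩ := hnint _ (hint (Fin.init u)).2.2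
      refine ⟨coordB (u (Fin.last k)) * z1 + coordA (u (Fin.last k)) * z2, ?_⟩
      push_cast
      rw [← hz1, ← hz2]
      simp only [v]; ring
    have hnpow : ∀ j, (nn : ℝ) ≤ (nn : ℝ) ^ (j + 1) := fun j => le_self_pow₀ hnn1' (by omega)
    have hinv : 1 / (nn : ℝ) ≤ ε / 6 := by
      rw [div_le_div_iff₀ hnn0 (by norm_num)]; nlinarith
    have hlinsmall : ∀ w : ℤ, (w = 0 ∨ w = 1) → |(w : ℝ) / (2 * K * nn)| ≤ ε / 6 := by
      intro w hw
      refine le_trans ?_ hinv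
      rw [abs_div, abs_mul, abs_mul, abs_two, Nat.abs_cast]
      have : |(w : ℝ)| ≤ 1 := by rcases hw with h | h <;> simp [h]
      gcongr
      nlinarith
    -- `q / (2 c nn ^ (e + 2))` meets the leading term of `p` and gives the diagonal part of the
    -- form; `v / nn ^ (e + 1)` meets the coefficient `(e + 2) c N` of the Taylor expansion at the
    -- previous sum `N`, and gives the cross terms
    refine ⟨Fin.snoc n nn,
      fun u => y (Fin.init u) + (q u / (2 * c * (nn : ℝ) ^ (e + 2)) + v u / (nn : ℝ) ^ (e + 1)),
      fun u => va (Fin.init u) + coordA (u (Fin.last k)) / (2 * K * nn),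
      fun u => vb (Fin.init u) + coordB (u (Fin.last k)) / (2 * K * nn),
      Q * (2 * K * (nn : ℤ) ^ (e + 2)), ?_, ?_, ?_, ?_, ?_, ?_⟩
    · intro i j hij
      induction j using Fin.lastCases with
      | last =>
        induction i using Fin.lastCases with
        | last => exact absurd hij (lt_irrefl _)
        | cast i => simpa using hngt i
      | cast j =>
        induction i using Fin.lastCases with
        | last => exact absurd hij (Fin.castSucc_lt_last j).not_gt
        | cast i => simpa using hmono (by simpa using hij)
    · intro i
      induction i using Fin.lastCases with
      | last => simpa using ⟨hnn1, Dvd.intro _ (by rw [hnndef, mul_assoc])⟩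
      | cast i => simpa using hn i
    · exact mul_ne_zero hQ (mul_ne_zero (mul_ne_zero two_ne_zero hK)
        (pow_ne_zero _ (by exact_mod_cast (Nat.one_le_iff_ne_zero.1 hnn1))))
    · intro u
      refine ⟨?_, ?_, ?_⟩
      · have h1 := (hsmall (Fin.init u)).1
        have h2 : |(q u : ℝ) / (2 * c * (nn : ℝ) ^ (e + 2))| ≤ ε / 4 := by
          have : |(q u : ℝ) / (2 * c * (nn : ℝ) ^ (e + 2))| ≤ (3 / 2) * (1 / nn) := by
            rw [abs_div, abs_mul, abs_mul, abs_two, abs_pow, Nat.abs_cast, div_mul_div_comm]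
            have h3 := hnpow (e + 1)
            have h4 := hq u
            rw [mul_one]
            gcongr
            nlinarith
          linarith
        have h3 : |v u / (nn : ℝ) ^ (e + 1)| ≤ 2 * ε' := by
          rw [abs_div, abs_pow, Nat.abs_cast]
          exact (div_le_self (abs_nonneg _) (hnn1'.trans (hnpow e))).trans (hv u)
        refine (abs_add_le _ _).trans ((add_le_add h1 (abs_add_le _ _)).trans ?_)
        linarith
      · refine (abs_add_le _ _).trans ?_
        linarith [(hsmall (Fin.init u)).2.1, hlinsmall _ (coordA_cases (u (Fin.last k)))]
      · refine (abs_add_le _ _).trans ?_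
        linarith [(hsmall (Fin.init u)).2.2, hlinsmall _ (coordB_cases (u (Fin.last k)))]
    · intro u
      obtain ⟨⟨z1, hz1⟩, ⟨z2, hz2⟩, ⟨z3, hz3⟩⟩ := hint (Fin.init u)
      obtain ⟨z4, hz4⟩ := hvint u
      refine ⟨⟨2 * K * nn ^ (e + 2) * z1 + Q * (e + 2) * q u + Q * 2 * K * z4, ?_⟩,
        ⟨2 * K * nn ^ (e + 2) * z2 + Q * nn ^ (e + 1) * coordA (u (Fin.last k)), ?_⟩,
        ⟨2 * K * nn ^ (e + 2) * z3 + Q * nn ^ (e + 1) * coordB (u (Fin.last k)), ?_⟩⟩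
      · push_cast
        rw [← hz1, ← hz4, hKdef]
        push_cast
        field_simp
        ring
      · push_cast
        rw [← hz2]
        field_simp
        ring
      · push_cast
        rw [← hz3]
        field_simp
        ring
    · intro η hη u
      have hη' : ∀ i : Fin k, |η i.castSucc| ≤ 1 := fun i => hη _
      obtain ⟨h1, h2, h3⟩ := hmain (fun i => η i.castSucc) hη' (Fin.init u)
      have hHη := hH _ hη'
      have hHη' := hH' _ hη'
      simp only [Fin.sum_univ_castSucc, Fin.snoc_castSucc, Fin.snoc_last]
      simp only [Fin.init] at h1 h2 h3
      set N : ℤ := ∑ i : Fin k, η i.castSucc * (n i : ℤ) with hN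
      set A : ℤ := ∑ i : Fin k, η i.castSucc * coordA (u i.castSucc) with hA
      set B : ℤ := ∑ i : Fin k, η i.castSucc * coordB (u i.castSucc) with hB
      set η₀ := η (Fin.last k) with hη₀
      have hη₀1 : |η₀| ≤ 1 := hη _
      have hNn : |(N : ℝ)| / nn ≤ ε / 6 := by
        rw [div_le_div_iff₀ hnn0 (by norm_num)]; nlinarith
      refine ⟨?_, ?_, ?_⟩
      · have hz := eval_mul_increment p e hp hc N η₀ (q u) hη₀1 (hq u) nn hnn1 (v u)
          (by linarith [hv u]) (hvint u) H hHη
        obtain ⟨j, hj⟩ := normForm_increment_parity e η₀ A B (coordA (u (Fin.last k)))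
          (coordB (u (Fin.last k)))
        obtain ⟨z1, hz1⟩ := hnint _ (hint (Fin.init u)).1
        have hdvd : (nn : ℤ) ∣ p.eval (N + η₀ * nn) - p.eval N := by
          refine dvd_trans ?_ (Polynomial.sub_dvd_eval_sub _ _ p)
          simp
        -- hence the old phase `y` does not see the increment of `p`
        obtain ⟨s, hs⟩ := hdvd
        have hs' : ((p.eval (N + η₀ * nn) : ℤ) : ℝ) - (p.eval N : ℤ) = nn * s := by
          exact_mod_cast hs
        have t2 := h2.int_mul (η₀ ^ (e + 1) * coordB (u (Fin.last k)))
        have t3 := h3.int_mul (η₀ ^ (e + 1) * coordA (u (Fin.last k)))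
        have habs : ∀ w : ℤ, (w = 0 ∨ w = 1) → |((η₀ ^ (e + 1) * w : ℤ) : ℝ)| ≤ 1 := by
          intro w hw
          have : |(η₀ : ℝ)| ≤ 1 := by exact_mod_cast hη₀1
          have h5 : |(η₀ : ℝ)| ^ (e + 1) ≤ 1 := pow_le_one₀ (abs_nonneg _) this
          rcases hw with h | h <;> rw [h] <;> simp [abs_pow, h5]
        have e2 : |((η₀ ^ (e + 1) * coordB (u (Fin.last k)) : ℤ) : ℝ)| * ε' ≤ ε' :=
          mul_le_of_le_one_left hε'.le (habs _ (coordB_cases _))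
        have e3 : |((η₀ ^ (e + 1) * coordA (u (Fin.last k)) : ℤ) : ℝ)| * ε' ≤ ε' :=
          mul_le_of_le_one_left hε'.le (habs _ (coordA_cases _))
        have total := (((h1.add hz).add t2).add t3).add
          (nearInt_int (s * z1 + j))
        have hbound : ε' + (|(p.coeff (e + 1) : ℝ) * v u| + 4 * H / nn)
            + |((η₀ ^ (e + 1) * coordB (u (Fin.last k)) : ℤ) : ℝ)| * ε'
            + |((η₀ ^ (e + 1) * coordA (u (Fin.last k)) : ℤ) : ℝ)| * ε' + 0 ≤ ε := by
          have b1 : |(p.coeff (e + 1) : ℝ) * v u| ≤ |(c' : ℝ)| * (2 * ε') := by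
            rw [abs_mul]; exact mul_le_mul_of_nonneg_left (hv u) (abs_nonneg _)
          have b2 : 4 * H / nn ≤ ε / 2 := by
            rw [div_le_div_iff₀ hnn0 (by norm_num)]; nlinarith
          nlinarith [abs_nonneg (c' : ℝ)]
        refine NearInt.mono ?_ hbound
        convert total using 1
        have hK' : (K : ℝ) = (e + 2) * c := by rw [hKdef]; push_cast; ring
        have hvdef : v u = coordB (u (Fin.last k)) * va (Fin.init u)
          + coordA (u (Fin.last k)) * vb (Fin.init u) := rfl
        have hqdef : normForm (coordA (u (Fin.last k))) (coordB (u (Fin.last k))) = q u := rfl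
        rw [hqdef] at hj
        rw [hK']
        push_cast at hj ⊢
        rw [← hj, ← hz1, ← hcdef]
        have hs2 : (s : ℝ) * (nn * y (Fin.init u))
            = (((p.eval (N + η₀ * nn) : ℤ) : ℝ) - (p.eval N : ℤ)) * y (Fin.init u) := by
          rw [hs']; ring
        rw [hs2, hvdef]
        ring
      · exact (linear_phase_increment K N η₀ A _ hK (coordA_cases _) nn hnn1 _ _
          (hnint _ (hint _).2.1) h2).mono (by linarith)
      · exact (linear_phase_increment K N η₀ B _ hK (coordB_cases _) nn hnn1 _ _
          (hnint _ (hint _).2.2) h3).mono (by linarith)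

/-! ### One summand of the random frequency -/

lemma cos_two_pi_half_int (m : ℤ) :
    Real.cos (2 * Real.pi * ((m : ℝ) / 2)) = if Even m then 1 else -1 := by
  rw [show 2 * Real.pi * ((m : ℝ) / 2) = m * Real.pi by ring, Real.cos_int_mul_pi]
  split_ifs with h
  · exact h.neg_one_zpow
  · exact (Int.not_even_iff_odd.1 h).neg_one_zpow

/-- Translation by a point of `𝔽₂²` permutes the four values of the form: one is even and three
are odd. -/
lemma sum_cos_normForm_translate (A B η : ℤ) (hη : |η| ≤ 1) (hη0 : η ≠ 0) :
    ∑ w : Fin 2 × Fin 2, Real.cos (2 * Real.pi *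
      ((normForm (A + η * coordA w) (B + η * coordB w) : ℝ) / 2)) = -2 := by
  have hodd : ¬ Even η := by
    rw [abs_le] at hη
    rw [Int.not_even_iff_odd, Int.odd_iff]
    omega
  simp only [cos_two_pi_half_int, Fintype.sum_prod_type, Fin.sum_univ_two, coordA, coordB,
    normForm, Int.even_add, Int.even_mul, Int.even_pow]
  by_cases h2 : Even A <;> by_cases h3 : Even B <;> simp [h2, h3, hodd] <;> norm_num

/-- A nonzero linear combination with odd or zero coefficients of uniform points of `𝔽₂²` is again
uniform, so the average of the signs `(-1) ^ normForm` is `(1 - 3) / 4`. -/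
lemma sum_cos_normForm (k : ℕ) (η : Fin k → ℤ) (hη : ∀ i, |η i| ≤ 1) (hη0 : ∃ i, η i ≠ 0) :
    ∑ u : Fin k → Fin 2 × Fin 2, Real.cos (2 * Real.pi *
      ((normForm (∑ i, η i * coordA (u i)) (∑ i, η i * coordB (u i)) : ℝ) / 2)) =
      -(1 / 2) * 4 ^ k := by
  obtain ⟨i, hi⟩ := hη0
  cases k with
  | zero => exact i.elim0
  | succ k =>
    rw [← (Fin.insertNthEquiv (fun _ => Fin 2 × Fin 2) i).sum_comp, Fintype.sum_prod_type_right]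
    simp only [Fin.insertNthEquiv_apply, Fin.sum_univ_succAbove _ i, Fin.insertNth_apply_same,
      Fin.insertNth_apply_succAbove]
    have (u : Fin k → Fin 2 × Fin 2) := sum_cos_normForm_translate
      (∑ j, η (i.succAbove j) * coordA (u j)) (∑ j, η (i.succAbove j) * coordB (u j)) _ (hη i) hi
    simp only [add_comm (∑ j, η (i.succAbove j) * coordA _),
      add_comm (∑ j, η (i.succAbove j) * coordB _)] at this
    simp only [this, Finset.sum_const, Finset.card_univ, Fintype.card_fun, Fintype.card_prod,
      Fintype.card_fin, nsmul_eq_mul]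
    push_cast
    ring

/-- The finite sample space of the `t`-th summand of the random frequency: a bit, which produces
mixing, and `t` points of `𝔽₂²`, which produce negative correlations. -/
abbrev Stage (t : ℕ) : Type := Fin 2 × (Fin t → Fin 2 × Fin 2)

/-- One summand `X` of the random frequency, on the scale `R`: the quadratic phase of
`exists_quadratic_phases` plus a much smaller bit phase `bit / (2 m)`, where `m` clears the
denominators of the former and is large compared with the values of `p` at the sums considered. -/
theorem exists_stage (p : Polynomial ℤ) (hdeg : 1 < p.natDegree) (t R : ℕ) (hR : 0 < R) :
    ∃ (X : Stage t → ℝ) (n : Fin t → ℕ) (m R' : ℕ),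
      (∀ ω, |X ω| ≤ 1 / (2 ^ t * R)) ∧ StrictMono n ∧ (∀ i, 0 < n i ∧ R ∣ n i) ∧
      R ∣ m ∧ m ≤ R' ∧ (∀ ω : Stage t, ∃ z : ℤ, m * X ω - ((ω.1 : ℕ) : ℝ) / 2 = z) ∧
      R ∣ R' ∧ R < R' ∧ (∀ ω, ∃ z : ℤ, R' * X ω = z) ∧
      ∀ η : Fin t → ℤ, (∀ i, |η i| ≤ 1) →
        |((p.eval (∑ i, η i * (n i : ℤ)) : ℤ) : ℝ)| ≤ R' ∧
        ∀ ω : Stage t, NearInt (1 / 2 ^ t) ((p.eval (∑ i, η i * (n i : ℤ)) : ℤ) * X ω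
          - (normForm (∑ i, η i * coordA (ω.2 i)) (∑ i, η i * coordB (ω.2 i)) : ℝ) / 2) := by
  obtain ⟨e, he⟩ : ∃ e, p.natDegree = e + 2 := ⟨p.natDegree - 2, by omega⟩
  have hc : p.coeff (e + 2) ≠ 0 := by
    rw [← he, Polynomial.coeff_natDegree]
    intro h
    rw [Polynomial.leadingCoeff_eq_zero] at h
    simp [h] at hdeg
  have hR0 : (0 : ℝ) < R := by exact_mod_cast hR
  have hR1 : (1 : ℝ) ≤ R := by exact_mod_cast hR
  set ε : ℝ := 1 / (2 ^ (t + 1) * R) with hε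
  have hε0 : 0 < ε := by positivity
  have hε1 : ε ≤ 1 / 2 ^ (t + 1) := by
    rw [hε]
    exact one_div_le_one_div_of_le (by positivity) (le_mul_of_one_le_right (by positivity) hR1)
  have hε2 : 1 / (2 ^ t * R) = ε + ε := by rw [hε]; field_simp; ring
  have hε3 : (1 : ℝ) / 2 ^ t = 1 / 2 ^ (t + 1) + 1 / 2 ^ (t + 1) := by field_simp; ring
  obtain ⟨n, y, va, vb, Q, hmono, hn, hQ, hsmall, hint, hmain⟩ :=
    exists_quadratic_phases p e he.le hc t R hR ε hε0
  obtain ⟨H, hH0, hH⟩ := exists_signs_bound t fun η =>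
    |((p.eval (∑ i, η i * (n i : ℤ)) : ℤ) : ℝ)|
  obtain ⟨M, hM⟩ := exists_nat_ge ((H + 1) / ε + 1)
  obtain ⟨H', hH'⟩ := exists_nat_ge H
  have hMq : 0 ≤ (H + 1) / ε := by positivity
  have hM0 : (1 : ℝ) ≤ M := by linarith
  have hM1 : 1 ≤ M := by exact_mod_cast hM0
  have hMε : H + 1 ≤ ε * M := by
    have : (H + 1) / ε ≤ M := by linarith
    rwa [div_le_iff₀' hε0] at this
  set m : ℕ := R * Q.natAbs * M with hm
  have hQ1 : 1 ≤ Q.natAbs := Nat.one_le_iff_ne_zero.2 (Int.natAbs_ne_zero.2 hQ)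
  have hmM : M ≤ m := Nat.le_mul_of_pos_left _ (Nat.mul_pos hR hQ1)
  have hmM' : (M : ℝ) ≤ m := by exact_mod_cast hmM
  have hm0 : (0 : ℝ) < m := by linarith
  have hmR : R ≤ m := by
    rw [hm, mul_assoc]; exact Nat.le_mul_of_pos_right _ (Nat.mul_pos hQ1 hM1)
  have hmy : ∀ u, ∃ z : ℤ, m * y u = z := by
    intro u
    obtain ⟨z, hz⟩ := (hint u).1
    refine ⟨R * Q.sign * M * z, ?_⟩
    have : (m : ℝ) = ((R * (Q.sign * Q) * M : ℤ) : ℝ) := by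
      rw [Int.sign_mul_self_eq_abs, hm]
      push_cast
      rw [Nat.cast_natAbs, Int.cast_abs]
    rw [this]
    push_cast
    rw [← hz]; ring
  have hbit : ∀ ω : Stage t, |((ω.1 : ℕ) : ℝ) / (2 * m)| ≤ 1 / M := by
    intro ω
    have h1 : ((ω.1 : ℕ) : ℝ) ≤ 1 := by
      have : (ω.1 : ℕ) ≤ 1 := by omega
      exact_mod_cast this
    rw [abs_of_nonneg (by positivity), div_le_div_iff₀ (by positivity) (by positivity)]
    nlinarith
  refine ⟨fun ω => y ω.2 + ((ω.1 : ℕ) : ℝ) / (2 * m), n, m, 2 * m * (H' + 1), ?_, hmono, hn,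
    ⟨Q.natAbs * M, by rw [hm, mul_assoc]⟩, ?_, ?_, ?_, ?_, ?_, ?_⟩
  · intro ω
    rw [hε2]
    refine (abs_add_le _ _).trans (add_le_add (hsmall _).1 ((hbit ω).trans ?_))
    rw [div_le_iff₀ (by positivity)]; linarith
  · nlinarith
  · intro ω
    obtain ⟨z, hz⟩ := hmy ω.2
    refine ⟨z, ?_⟩
    rw [← hz]; field_simp; ring
  · exact Dvd.dvd.mul_right (Dvd.dvd.mul_left ⟨Q.natAbs * M, by rw [hm, mul_assoc]⟩ 2) _
  · nlinarith
  · intro ω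
    obtain ⟨z, hz⟩ := hmy ω.2
    refine ⟨2 * (H' + 1) * z + (ω.1 : ℕ) * (H' + 1), ?_⟩
    push_cast
    rw [← hz]; field_simp
  · intro η hη
    have hb := hH η hη
    refine ⟨?_, fun ω => ?_⟩
    · refine hb.trans ?_
      push_cast
      have : (1 : ℝ) ≤ m := by linarith
      nlinarith
    · have h1 := (hmain η hη ω.2).1
      have h2 : |((p.eval (∑ i, η i * (n i : ℤ)) : ℤ) : ℝ) * (((ω.1 : ℕ) : ℝ) / (2 * m))| ≤ ε := by
        rw [abs_mul]
        calc _ ≤ H * (1 / M) := by gcongr; exact hbit ω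
          _ ≤ ε := by rw [mul_one_div, div_le_iff₀ (by positivity)]; linarith
      obtain ⟨z, hz⟩ := (h1.add (nearInt_of_abs_le h2)).mono
        (show ε + ε ≤ 1 / 2 ^ t by linarith)
      refine ⟨z, ?_⟩
      convert hz using 2
      ring

/-! ### The random frequency and its Fourier coefficients -/

/-- The summands `X t` of a random frequency, on scales separated by a divisibility chain `R`:
`X t` takes values in `R (t + 1)⁻¹ ℤ` and is at most `1 / (2 ^ t R t)`. The integers `n t i` are
those along which the polynomial `p` produces negative correlations, the integers `m t` those
along which the system mixes. -/
structure FrequencyData (p : Polynomial ℤ) where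
  /-- The divisibility chain; `R t` is also a time of rigidity. -/
  R : ℕ → ℕ
  /-- The summands, as functions on finite sample spaces. -/
  X : (t : ℕ) → Stage t → ℝ
  /-- The integers whose signed sums carry negative correlations. -/
  n : (t : ℕ) → Fin t → ℕ
  /-- The mixing times. -/
  m : ℕ → ℕ
  R_pos : ∀ t, 0 < R t
  R_lt : ∀ t, R t < R (t + 1)
  R_dvd : ∀ t, R t ∣ R (t + 1)
  X_le : ∀ t ω, |X t ω| ≤ 1 / (2 ^ t * R t)
  X_int : ∀ t ω, ∃ z : ℤ, R (t + 1) * X t ω = z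
  n_strictMono : ∀ t, StrictMono (n t)
  n_pos : ∀ t i, 0 < n t i
  n_dvd : ∀ t i, R t ∣ n t i
  m_dvd : ∀ t, R t ∣ m t
  m_le : ∀ t, m t ≤ R (t + 1)
  m_mul_X : ∀ t, ∀ ω : Stage t, ∃ z : ℤ, m t * X t ω - ((ω.1 : ℕ) : ℝ) / 2 = z
  eval_le : ∀ t, ∀ η : Fin t → ℤ, (∀ i, |η i| ≤ 1) →
    |((p.eval (∑ i, η i * (n t i : ℤ)) : ℤ) : ℝ)| ≤ R (t + 1)
  eval_mul_X : ∀ t, ∀ η : Fin t → ℤ, (∀ i, |η i| ≤ 1) → ∀ ω : Stage t,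
    NearInt (1 / 2 ^ t) ((p.eval (∑ i, η i * (n t i : ℤ)) : ℤ) * X t ω
      - (normForm (∑ i, η i * coordA (ω.2 i)) (∑ i, η i * coordB (ω.2 i)) : ℝ) / 2)

/-- Iterating `exists_stage`, with the common denominator of one summand as the scale of the
next one. -/
theorem nonempty_frequencyData (p : Polynomial ℤ) (hdeg : 1 < p.natDegree) :
    Nonempty (FrequencyData p) := by
  choose X n m R' h1 h2 h3 h4 h5 h6 h7 h8 h9 h10 using exists_stage p hdeg
  let S : ℕ → {R : ℕ // 0 < R} := fun t => Nat.rec ⟨1, one_pos⟩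
    (fun t R => ⟨R' t R.1 R.2, (Nat.zero_le _).trans_lt (h8 t R.1 R.2)⟩) t
  exact ⟨{
    R := fun t => (S t).1
    X := fun t => X t (S t).1 (S t).2
    n := fun t => n t (S t).1 (S t).2
    m := fun t => m t (S t).1 (S t).2
    R_pos := fun t => (S t).2
    R_lt := fun t => h8 t _ (S t).2
    R_dvd := fun t => h7 t _ (S t).2
    X_le := fun t => h1 t _ (S t).2
    X_int := fun t => h9 t _ (S t).2
    n_strictMono := fun t => h2 t _ (S t).2
    n_pos := fun t i => (h3 t _ (S t).2 i).1
    n_dvd := fun t i => (h3 t _ (S t).2 i).2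
    m_dvd := fun t => h4 t _ (S t).2
    m_le := fun t => h5 t _ (S t).2
    m_mul_X := fun t => h6 t _ (S t).2
    eval_le := fun t η hη => (h10 t _ (S t).2 η hη).1
    eval_mul_X := fun t η hη => (h10 t _ (S t).2 η hη).2 }⟩

lemma abs_cos_sub_cos_le_of_nearInt {ε a b : ℝ} (h : NearInt ε (a - b)) :
    |Real.cos (2 * Real.pi * a) - Real.cos (2 * Real.pi * b)| ≤ 2 * Real.pi * ε := by
  obtain ⟨m, hm⟩ := h
  have h1 : Real.cos (2 * Real.pi * a) = Real.cos (2 * Real.pi * (a - m)) := by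
    rw [show 2 * Real.pi * (a - m) = 2 * Real.pi * a - m * (2 * Real.pi) by ring,
      Real.cos_sub_int_mul_two_pi]
  rw [h1]
  refine (Real.abs_cos_sub_cos_le _ _).trans ?_
  rw [← mul_sub, abs_mul, abs_of_pos Real.two_pi_pos,
    show a - m - b = a - b - m by ring]
  exact mul_le_mul_of_nonneg_left hm Real.two_pi_pos.le

lemma abs_integral_sub_le {Ω : Type*} [MeasurableSpace Ω] {P : Measure Ω} [IsProbabilityMeasure P]
    {f g : Ω → ℝ} (hf : Integrable f P) (hg : Integrable g P) {C : ℝ}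
    (h : ∀ ω, |f ω - g ω| ≤ C) : |∫ ω, f ω ∂P - ∫ ω, g ω ∂P| ≤ C := by
  rw [← integral_sub hf hg]
  simpa using norm_integral_le_of_norm_le_const (μ := P) (f := fun ω => f ω - g ω)
    (Eventually.of_forall h)

/-- The uniform distribution on the `t`-th finite sample space. -/
noncomputable def stageMeasure (t : ℕ) : Measure (Stage t) :=
  (PMF.uniformOfFintype (Stage t)).toMeasure

instance (t : ℕ) : IsProbabilityMeasure (stageMeasure t) := by
  unfold stageMeasure; infer_instance

lemma integral_stageMeasure (t : ℕ) (f : Stage t → ℝ) :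
    ∫ ω, f ω ∂(stageMeasure t) = (2 * 4 ^ t)⁻¹ * ∑ ω, f ω := by
  rw [stageMeasure, PMF.integral_eq_sum, Finset.mul_sum]
  refine Finset.sum_congr rfl fun ω _ => ?_
  simp [Fintype.card_prod, ENNReal.toReal_mul]

/-- The law of all the independent choices. -/
noncomputable abbrev stagesMeasure : Measure ((t : ℕ) → Stage t) :=
  Measure.infinitePi stageMeasure

lemma integral_eval_stagesMeasure (t : ℕ) (f : Stage t → ℝ) :
    ∫ ω, f (ω t) ∂stagesMeasure = (2 * 4 ^ t)⁻¹ * ∑ ω, f ω := by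
  rw [← integral_stageMeasure]
  have h := measurePreserving_eval_infinitePi stageMeasure t
  rw [← h.map_eq, integral_map h.measurable.aemeasurable
    (Measurable.of_discrete).aestronglyMeasurable]

namespace FrequencyData

variable {p : Polynomial ℤ} (d : FrequencyData p)

lemma R_mono : StrictMono d.R := strictMono_nat_of_lt_succ d.R_lt

lemma R_dvd_of_le {s t : ℕ} (h : s ≤ t) : d.R s ∣ d.R t := by
  induction t, h using Nat.le_induction with
  | base => exact dvd_rfl
  | succ t _ ih => exact ih.trans (d.R_dvd t)

lemma one_le_R (t : ℕ) : (1 : ℝ) ≤ d.R t := by exact_mod_cast d.R_pos t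

/-- The sum of all summands from the `t`-th one on. -/
noncomputable def tail (t : ℕ) (ω : (t : ℕ) → Stage t) : ℝ := ∑' s, d.X (s + t) (ω (s + t))

/-- The random frequency, before reduction modulo `1`. -/
noncomputable def freq (ω : (t : ℕ) → Stage t) : ℝ := ∑' s, d.X s (ω s)

lemma norm_X_add_le (ω : (t : ℕ) → Stage t) (t s : ℕ) :
    ‖d.X (s + t) (ω (s + t))‖ ≤ (1 / (2 ^ t * d.R t)) * (1 / 2) ^ s := by
  refine (d.X_le _ _).trans ?_
  have h1 : (d.R t : ℝ) ≤ d.R (s + t) := by exact_mod_cast d.R_mono.monotone (by omega)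
  have h2 := d.one_le_R t
  rw [one_div_pow, one_div_mul_one_div]
  refine one_div_le_one_div_of_le (by positivity) ?_
  rw [pow_add]
  calc (2 : ℝ) ^ t * d.R t * 2 ^ s = 2 ^ s * 2 ^ t * d.R t := by ring
    _ ≤ _ := by gcongr

lemma summable_X (ω : (t : ℕ) → Stage t) : Summable fun s => d.X s (ω s) :=
  Summable.of_norm_bounded (summable_geometric_two.mul_left _) fun s => d.norm_X_add_le ω 0 s

lemma abs_tail_le (t : ℕ) (ω : (t : ℕ) → Stage t) : |d.tail t ω| ≤ 2 / (2 ^ t * d.R t) := by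
  have := tsum_of_norm_bounded (hasSum_geometric_two.mul_left _) (d.norm_X_add_le ω t)
  rw [one_div_mul_eq_div] at this
  exact this

lemma freq_eq (t : ℕ) (ω : (t : ℕ) → Stage t) :
    d.freq ω = ∑ s ∈ Finset.range t, d.X s (ω s) + d.tail t ω :=
  ((d.summable_X ω).sum_add_tsum_nat_add t).symm

lemma measurable_X_eval (t : ℕ) : Measurable fun ω : (t : ℕ) → Stage t => d.X t (ω t) :=
  (Measurable.of_discrete (f := d.X t)).comp (measurable_pi_apply t)

lemma measurable_freq : Measurable d.freq := by
  refine measurable_of_tendsto_metrizable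
    (f := fun t ω => ∑ s ∈ Finset.range t, d.X s (ω s)) (fun t => ?_) ?_
  · exact Finset.measurable_sum _ fun s _ => d.measurable_X_eval s
  · exact tendsto_pi_nhds.2 fun ω => (d.summable_X ω).hasSum.tendsto_sum_nat

/-- The Fourier coefficients of the law of the random frequency (their real parts). -/
noncomputable def coeff (n : ℤ) : ℝ :=
  ∫ ω, Real.cos (2 * Real.pi * (n * d.freq ω)) ∂stagesMeasure

lemma integrable_cos {g : ((t : ℕ) → Stage t) → ℝ} (hg : Measurable g) :
    Integrable (fun ω => Real.cos (2 * Real.pi * g ω)) stagesMeasure := by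
  refine Integrable.of_bound (by fun_prop) 1 (Eventually.of_forall fun ω => ?_)
  exact Real.abs_cos_le_one _

/-- An integer divisible by `R t` and bounded by `R (t + 1)` sees only the `t`-th summand of the
random frequency. -/
lemma nearInt_mul_freq (t : ℕ) (N : ℤ) (hdvd : (d.R t : ℤ) ∣ N) (hN : |(N : ℝ)| ≤ d.R (t + 1))
    (ω : (t : ℕ) → Stage t) : NearInt (1 / 2 ^ t) (N * d.freq ω - N * d.X t (ω t)) := by
  have hint : ∃ z : ℤ, N * ∑ s ∈ Finset.range t, d.X s (ω s) = z := by
    have : ∀ s ∈ Finset.range t, ∃ z : ℤ, N * d.X s (ω s) = z := by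
      intro s hs
      have h1 : (d.R (s + 1) : ℤ) ∣ N :=
        (Int.natCast_dvd_natCast.2 (d.R_dvd_of_le (Finset.mem_range.1 hs))).trans hdvd
      obtain ⟨a, ha⟩ := h1
      obtain ⟨z, hz⟩ := d.X_int s (ω s)
      refine ⟨a * z, ?_⟩
      rw [ha]; push_cast; rw [← hz]; ring
    choose! z hz using this
    refine ⟨∑ s ∈ Finset.range t, z s, ?_⟩
    rw [Finset.mul_sum]
    push_cast
    exact Finset.sum_congr rfl hz
  obtain ⟨z, hz⟩ := hint
  have htail : |N * d.tail (t + 1) ω| ≤ 1 / 2 ^ t := by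
    have hR := d.one_le_R (t + 1)
    rw [abs_mul]
    calc |(N : ℝ)| * |d.tail (t + 1) ω|
        ≤ d.R (t + 1) * (2 / (2 ^ (t + 1) * d.R (t + 1))) := by
          gcongr; exact d.abs_tail_le _ _
      _ = 1 / 2 ^ t := by field_simp; ring
  refine ⟨z, ?_⟩
  rw [d.freq_eq (t + 1), Finset.sum_range_succ, ← hz]
  convert htail using 2
  ring

lemma tendsto_const_mul_pow_half (C : ℝ) :
    Tendsto (fun t : ℕ => C * (1 / 2 ^ t : ℝ)) atTop (𝓝 0) := by
  have := (tendsto_pow_atTop_nhds_zero_of_lt_one (r := (1 / 2 : ℝ)) (by norm_num)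
    (by norm_num)).const_mul C
  simpa using this

/-- Rigidity of the coefficients: `R t` times the random frequency is close to an integer, the
earlier summands being annihilated and the later ones small. -/
theorem tendsto_coeff_R_add (j : ℤ) :
    Tendsto (fun t => d.coeff (d.R t + j)) atTop (𝓝 (d.coeff j)) := by
  rw [tendsto_iff_dist_tendsto_zero]
  refine squeeze_zero (fun _ => dist_nonneg) (fun t => ?_)
    (tendsto_const_mul_pow_half (2 * Real.pi * 2))
  have h := abs_integral_sub_le (P := stagesMeasure) (C := 2 * Real.pi * (2 * (1 / 2 ^ t)))
    (integrable_cos (g := fun ω => ((d.R t + j : ℤ) : ℝ) * d.freq ω)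
      (d.measurable_freq.const_mul _))
    (integrable_cos (g := fun ω => (j : ℝ) * d.freq ω) (d.measurable_freq.const_mul _))
    fun ω => ?_
  · rw [Real.dist_eq, mul_assoc (2 * Real.pi)]
    exact h
  · have h1 := d.nearInt_mul_freq t (d.R t) dvd_rfl
      (by simpa using (Nat.cast_le (α := ℝ)).2 (d.R_lt t).le) ω
    have h2 : |((d.R t : ℤ) : ℝ) * d.X t (ω t)| ≤ 1 / 2 ^ t := by
      have hR := d.one_le_R t
      rw [abs_mul]
      simp only [Int.cast_natCast, Nat.abs_cast]
      calc (d.R t : ℝ) * |d.X t (ω t)| ≤ d.R t * (1 / (2 ^ t * d.R t)) := by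
            gcongr; exact d.X_le _ _
        _ = 1 / 2 ^ t := by field_simp
    refine abs_cos_sub_cos_le_of_nearInt ?_
    convert h1.add (nearInt_of_abs_le h2) using 1
    · ring
    · push_cast; ring

/-- Along the polynomial values at signed sums of the `n t i` the coefficients are close to
`-1 / 2`, the average of the signs in `sum_cos_normForm`. -/
theorem abs_coeff_eval_add_half_le (hp0 : p.eval 0 = 0) (t : ℕ) (η : Fin t → ℤ)
    (hη : ∀ i, |η i| ≤ 1) (hη0 : ∃ i, η i ≠ 0) :
    |d.coeff (p.eval (∑ i, η i * (d.n t i : ℤ))) + 1 / 2| ≤ 2 * Real.pi * 2 * (1 / 2 ^ t) := by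
  set S : ℤ := ∑ i, η i * (d.n t i : ℤ) with hS
  have hdvd : (d.R t : ℤ) ∣ p.eval S := by
    have h1 : (d.R t : ℤ) ∣ S := Finset.dvd_sum fun i _ =>
      Dvd.dvd.mul_left (Int.natCast_dvd_natCast.2 (d.n_dvd t i)) _
    have h2 := Polynomial.sub_dvd_eval_sub S 0 p
    rw [hp0, sub_zero, sub_zero] at h2
    exact h1.trans h2
  let q : Stage t → ℝ := fun ω =>
    (normForm (∑ i, η i * coordA (ω.2 i)) (∑ i, η i * coordB (ω.2 i)) : ℝ) / 2
  have hq : ∫ ω, Real.cos (2 * Real.pi * q (ω t)) ∂stagesMeasure = -(1 / 2) := by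
    rw [integral_eval_stagesMeasure t fun ω => Real.cos (2 * Real.pi * q ω),
      Fintype.sum_prod_type]
    simp only [q, sum_cos_normForm t η hη hη0]
    simp
    field_simp
  have h := abs_integral_sub_le (P := stagesMeasure) (C := 2 * Real.pi * (2 * (1 / 2 ^ t)))
    (integrable_cos (g := fun ω => ((p.eval S : ℤ) : ℝ) * d.freq ω)
      (d.measurable_freq.const_mul _))
    (integrable_cos (g := fun ω => q (ω t))
      ((Measurable.of_discrete (f := q)).comp (measurable_pi_apply t))) fun ω => ?_
  · rw [hq, sub_neg_eq_add] at h
    rw [mul_assoc (2 * Real.pi)]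
    exact h
  · refine abs_cos_sub_cos_le_of_nearInt ?_
    have h1 := (d.nearInt_mul_freq t _ hdvd (d.eval_le t η hη) ω).add
      (d.eval_mul_X t η hη (ω t))
    convert h1 using 1
    · ring
    · simp only [q]; ring

/-- Mixing of the coefficients: `m t` times the random frequency is, modulo `1` and up to a small
error, half of a bit which is independent of the earlier summands. -/
theorem tendsto_coeff_m_add (j : ℤ) :
    Tendsto (fun t => d.coeff (d.m t + j)) atTop (𝓝 0) := by
  rw [tendsto_iff_dist_tendsto_zero]
  refine squeeze_zero (fun _ => dist_nonneg) (fun t => ?_)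
    (tendsto_const_mul_pow_half (2 * Real.pi * (1 + 2 * |(j : ℝ)|)))
  let sgn : Stage t → ℝ := fun ω => Real.cos (2 * Real.pi * (((ω.1 : ℕ) : ℝ) / 2))
  let past : ((t : ℕ) → Stage t) → ℝ := fun ω => ∑ s ∈ Finset.range t, d.X s (ω s)
  have hpast : Measurable past := Finset.measurable_sum _ fun s _ => d.measurable_X_eval s
  have hsgn : Measurable sgn := .of_discrete
  -- the sign of the new bit is centred and independent of the past
  have hzero : ∫ ω, Real.cos (2 * Real.pi * (((ω t).1 : ℕ) / 2 + j * past ω)) ∂stagesMeasure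
      = 0 := by
    have hind : iIndepFun (fun (t : ℕ) (ω : (t : ℕ) → Stage t) => ω t) stagesMeasure :=
      iIndepFun_infinitePi (X := fun _ ω => ω) fun _ => measurable_id
    let T : Finset ℕ := {t}
    have htT : t ∈ T := Finset.mem_singleton_self t
    let φ : ((i : Finset.range t) → Stage i) → ℝ := fun g =>
      Real.cos (2 * Real.pi * (j * ∑ s : Finset.range t, d.X s (g s)))
    let ψ : ((i : T) → Stage i) → ℝ := fun g => sgn (g ⟨t, htT⟩)
    have hφ : Measurable φ := by
      have : Measurable fun g : ((i : Finset.range t) → Stage i) =>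
          ∑ s : Finset.range t, d.X s (g s) :=
        Finset.measurable_sum _ fun s _ =>
          (Measurable.of_discrete (f := d.X s)).comp (measurable_pi_apply s)
      fun_prop
    have hψ : Measurable ψ := hsgn.comp (measurable_pi_apply (⟨t, htT⟩ : T))
    have hind2 := hind.indepFun_finset (Finset.range t) T (by simp [T])
      fun i => measurable_pi_apply i
    have hmul := hind2.integral_fun_comp_mul_comp (f := φ) (g := ψ)
      (measurable_pi_lambda _ fun _ => measurable_pi_apply _).aemeasurable
      (measurable_pi_lambda _ fun _ => measurable_pi_apply _).aemeasurable
      hφ.aestronglyMeasurable hψ.aestronglyMeasurable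
    have hs0 : ∫ ω, sgn (ω t) ∂stagesMeasure = 0 := by
      rw [integral_eval_stagesMeasure, Fintype.sum_prod_type]
      simp [sgn, Fin.sum_univ_two]
      rw [show 2 * Real.pi * 2⁻¹ = Real.pi by ring, Real.cos_pi]
      simp
    change _ = _ * ∫ ω : (t : ℕ) → Stage t, sgn (ω t) ∂stagesMeasure at hmul
    rw [hs0, mul_zero] at hmul
    rw [← hmul]
    refine integral_congr_ae (Eventually.of_forall fun ω => ?_)
    have hsum : ∑ s : Finset.range t, d.X s (ω s) = past ω :=
      Finset.sum_coe_sort (Finset.range t) fun s => d.X s (ω s)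
    simp only [φ, ψ, hsum, sgn]
    have hsin : Real.sin (2 * Real.pi * (((ω t).1 : ℕ) / 2)) = 0 := by
      rw [show 2 * Real.pi * ((((ω t).1 : ℕ) : ℝ) / 2) = ((ω t).1 : ℕ) * Real.pi by ring]
      exact Real.sin_nat_mul_pi _
    rw [mul_add, Real.cos_add, hsin]
    ring
  have h := abs_integral_sub_le (P := stagesMeasure)
    (C := 2 * Real.pi * ((1 + 2 * |(j : ℝ)|) * (1 / 2 ^ t)))
    (integrable_cos (g := fun ω => ((d.m t + j : ℤ) : ℝ) * d.freq ω)
      (d.measurable_freq.const_mul _))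
    (integrable_cos (g := fun ω => (((ω t).1 : ℕ) / 2 + j * past ω)) (by
      have : Measurable fun ω : (t : ℕ) → Stage t => (((ω t).1 : ℕ) : ℝ) :=
        (Measurable.of_discrete (f := fun w : Stage t => ((w.1 : ℕ) : ℝ))).comp
          (measurable_pi_apply t)
      fun_prop)) fun ω => ?_
  · rw [hzero] at h
    rw [Real.dist_eq, mul_assoc (2 * Real.pi)]
    exact h
  · refine abs_cos_sub_cos_le_of_nearInt ?_
    have h1 := d.nearInt_mul_freq t (d.m t) (Int.natCast_dvd_natCast.2 (d.m_dvd t))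
      (by simpa using (Nat.cast_le (α := ℝ)).2 (d.m_le t)) ω
    obtain ⟨z, hz⟩ := d.m_mul_X t (ω t)
    have h2 : |j * d.tail t ω| ≤ 2 * |(j : ℝ)| * (1 / 2 ^ t) := by
      rw [abs_mul]
      have hR := d.one_le_R t
      calc |(j : ℝ)| * |d.tail t ω| ≤ |(j : ℝ)| * (2 / (2 ^ t * d.R t)) := by
            gcongr; exact d.abs_tail_le _ _
        _ ≤ |(j : ℝ)| * (2 / 2 ^ t) := by
            gcongr; exact le_mul_of_one_le_right (by positivity) hR
        _ = _ := by ring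
    have h3 := (h1.add (nearInt_of_abs_le h2)).add (nearInt_int z)
    convert h3 using 1
    · ring
    · rw [← hz]
      push_cast
      have h4 : (j : ℝ) * d.freq ω = j * (past ω + d.tail t ω) := by rw [d.freq_eq t]
      rw [add_mul, h4]
      ring

end FrequencyData

/-! ### Gaussian measures on sequences -/

section GramSchmidt

variable {H : Type*} [NormedAddCommGroup H] [InnerProductSpace ℝ H]

lemma inner_gramSchmidtNormed (f : ℕ → H) (j k : ℕ) (hjk : j ≠ k) :
    inner ℝ (InnerProductSpace.gramSchmidtNormed ℝ f j)
      (InnerProductSpace.gramSchmidtNormed ℝ f k) = 0 := by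
  simp [InnerProductSpace.gramSchmidtNormed, inner_smul_left, inner_smul_right,
    InnerProductSpace.gramSchmidt_orthogonal ℝ f hjk]

/-- Parseval's identity for `f m`, which lies in the span of the first `m + 1` vectors of the
Gram–Schmidt system. The vectors `f` need not be independent: the system may contain zeros. -/
lemma sum_inner_gramSchmidtNormed (f : ℕ → H) (m n : ℕ) (hmn : m ≤ n) (x : H) :
    ∑ k ∈ Finset.range (n + 1), inner ℝ (InnerProductSpace.gramSchmidtNormed ℝ f k) (f m) *
      inner ℝ (InnerProductSpace.gramSchmidtNormed ℝ f k) x = inner ℝ (f m) x := by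
  set e := InnerProductSpace.gramSchmidtNormed ℝ f with he
  have hmem : f m ∈ Submodule.span ℝ (e '' Set.Iic m) := by
    rw [he, InnerProductSpace.span_gramSchmidtNormed, InnerProductSpace.span_gramSchmidt_Iic]
    exact Submodule.subset_span ⟨m, Set.self_mem_Iic, rfl⟩
  generalize f m = y at hmem ⊢
  induction hmem using Submodule.span_induction with
  | mem y hy =>
    obtain ⟨j, hj, rfl⟩ := hy
    rw [Finset.sum_eq_single j]
    · by_cases h0 : e j = 0
      · simp [h0]
      · rw [real_inner_self_eq_norm_sq,
          InnerProductSpace.gramSchmidtNormed_unit_length' h0]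
        simp
    · intro k _ hkj
      rw [he, inner_gramSchmidtNormed f k j hkj, zero_mul]
    · intro h
      exact absurd (Finset.mem_range.2 (Nat.lt_succ_of_le (le_trans hj hmn))) h
  | zero => simp
  | add y z _ _ hy hz => simp [inner_add_left, inner_add_right, add_mul, Finset.sum_add_distrib,
      hy, hz]
  | smul c y _ hy =>
    simp only [inner_smul_left, inner_smul_right, mul_assoc, ← Finset.mul_sum, hy]
    rfl

end GramSchmidt

/-- The law of a sequence of independent standard Gaussian variables. -/
noncomputable abbrev iidGaussian : Measure (ℕ → ℝ) :=
  Measure.infinitePi fun _ => gaussianReal 0 1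

lemma isGaussianProcess_iidGaussian :
    IsGaussianProcess (fun (k : ℕ) (ω : ℕ → ℝ) => ω k) iidGaussian where
  hasGaussianLaw I := by
    have h : iIndepFun (fun (k : ℕ) (ω : ℕ → ℝ) => ω k) iidGaussian :=
      iIndepFun_infinitePi (X := fun _ ω => ω) fun _ => measurable_id
    refine iIndepFun.hasGaussianLaw (X := fun (i : I) (ω : ℕ → ℝ) => ω i) (fun i => ⟨?_⟩)
      (h.precomp Subtype.val_injective)
    rw [Measure.infinitePi_map_eval]
    infer_instance

lemma memLp_two_iidGaussian (k : ℕ) : MemLp (fun ω : ℕ → ℝ => ω k) 2 iidGaussian :=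
  (memLp_id_gaussianReal (μ := 0) (v := 1) 2).comp_measurePreserving
    (measurePreserving_eval_infinitePi (fun _ : ℕ => gaussianReal 0 1) k)

lemma integral_eval_iidGaussian (k : ℕ) : ∫ ω, ω k ∂iidGaussian = 0 := by
  have h := Measure.infinitePi_map_eval (fun _ : ℕ => gaussianReal 0 1) k
  have h2 := integral_id_gaussianReal (μ := 0) (v := 1)
  rw [← h, integral_map (measurable_pi_apply k).aemeasurable (by fun_prop)] at h2
  exact h2

lemma integral_mul_iidGaussian (k l : ℕ) :
    ∫ ω, ω k * ω l ∂iidGaussian = if k = l then 1 else 0 := by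
  split_ifs with hkl
  · subst hkl
    have h := Measure.infinitePi_map_eval (fun _ : ℕ => gaussianReal 0 1) k
    have h2 := variance_of_integral_eq_zero (μ := gaussianReal 0 1) (X := id) (by fun_prop)
      (by simp)
    rw [variance_id_gaussianReal, ← h,
      integral_map (measurable_pi_apply k).aemeasurable (by fun_prop)] at h2
    simp only [id, pow_two] at h2
    simpa using h2.symm
  · have h : iIndepFun (fun (k : ℕ) (ω : ℕ → ℝ) => ω k) iidGaussian :=
      iIndepFun_infinitePi (X := fun _ ω => ω) fun _ => measurable_id
    rw [(h.indepFun hkl).integral_fun_mul_eq_mul_integral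
      (measurable_pi_apply k).aestronglyMeasurable (measurable_pi_apply l).aestronglyMeasurable,
      integral_eval_iidGaussian, zero_mul]

/-- A centred Gaussian measure on two-sided sequences with the covariances of a given sequence of
vectors. Gram–Schmidt makes each coordinate a finite combination of independent standard Gaussian
variables, so no limit is needed. -/
theorem exists_gaussian_of_inner {H : Type*} [NormedAddCommGroup H] [InnerProductSpace ℝ H]
    (v : ℤ → H) :
    ∃ γ : Measure (ℤ → ℝ), IsProbabilityMeasure γ ∧
      IsGaussianProcess (fun (n : ℤ) (ω : ℤ → ℝ) => ω n) γ ∧ (∀ n, ∫ ω, ω n ∂γ = 0) ∧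
      ∀ m n, ∫ ω, ω m * ω n ∂γ = inner ℝ (v m) (v n) := by
  let num : ℤ ≃ ℕ := Equiv.intEquivNat
  let f : ℕ → H := fun k => v (num.symm k)
  let c : ℕ → ℕ → ℝ := fun n k => inner ℝ (InnerProductSpace.gramSchmidtNormed ℝ f k) (f n)
  let Y : ℕ → (ℕ → ℝ) → ℝ := fun n ω => ∑ k ∈ Finset.range (n + 1), c n k * ω k
  have hYm : ∀ n, Measurable (Y n) := fun n => by fun_prop
  have hcov : ∀ m n, m ≤ n → ∫ ω, Y m ω * Y n ω ∂iidGaussian = inner ℝ (f m) (f n) := by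
    intro m n hmn
    have hint : ∀ k l, Integrable (fun ω : ℕ → ℝ => c m k * ω k * (c n l * ω l)) iidGaussian :=
      fun k l => ((memLp_two_iidGaussian k).const_mul _).integrable_mul
        ((memLp_two_iidGaussian l).const_mul _)
    have h1 : ∀ k l, ∫ ω : ℕ → ℝ, c m k * ω k * (c n l * ω l) ∂iidGaussian
        = if k = l then c m k * c n l else 0 := by
      intro k l
      calc ∫ ω : ℕ → ℝ, c m k * ω k * (c n l * ω l) ∂iidGaussian
          = ∫ ω : ℕ → ℝ, (c m k * c n l) * (ω k * ω l) ∂iidGaussian := by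
            congr 1; ext ω; ring
        _ = _ := by rw [integral_const_mul, integral_mul_iidGaussian]; simp
    simp only [Y, Finset.sum_mul_sum]
    rw [integral_finsetSum _ fun k _ => integrable_finsetSum _ fun l _ => hint k l]
    simp_rw [integral_finsetSum _ fun l _ => hint _ l, h1]
    rw [← sum_inner_gramSchmidtNormed f m m le_rfl (f n)]
    refine Finset.sum_congr rfl fun k hk => ?_
    rw [Finset.sum_ite_eq, if_pos]
    exact Finset.mem_range.2 (by have := Finset.mem_range.1 hk; omega)
  have hcov' : ∀ m n, ∫ ω, Y m ω * Y n ω ∂iidGaussian = inner ℝ (f m) (f n) := by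
    intro m n
    rcases le_total m n with h | h
    · exact hcov m n h
    · rw [real_inner_comm, ← hcov n m h]
      simp_rw [mul_comm]
  have hgauss : IsGaussianProcess (fun (n : ℤ) => Y (num n)) iidGaussian := by
    refine isGaussianProcess_iidGaussian.of_isGaussianProcess fun n =>
      ⟨Finset.range (num n + 1),
        ∑ k : Finset.range (num n + 1), c (num n) k • ContinuousLinearMap.proj k, fun ω => ?_⟩
    simp only [Y, sum_apply, smul_apply,
      ContinuousLinearMap.proj_apply, Finset.restrict_def, smul_eq_mul]
    exact (Finset.sum_coe_sort (Finset.range (num n + 1)) fun k => c (num n) k * ω k).symm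
  let F : (ℕ → ℝ) → (ℤ → ℝ) := fun ω n => Y (num n) ω
  have hF : Measurable F := measurable_pi_lambda _ fun n => hYm _
  refine ⟨iidGaussian.map F, Measure.isProbabilityMeasure_map hF.aemeasurable,
    ⟨fun I => ⟨?_⟩⟩, fun n => ?_, fun m n => ?_⟩
  · rw [Measure.map_map (g := fun ω : ℤ → ℝ => I.restrict fun x => ω x)
      (measurable_pi_lambda _ fun i => measurable_pi_apply _) hF]
    exact (hgauss.hasGaussianLaw I).isGaussian_map
  · rw [integral_map hF.aemeasurable (measurable_pi_apply n).aestronglyMeasurable]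
    simp only [F, Y]
    rw [integral_finsetSum _ fun k _ =>
      ((memLp_two_iidGaussian k).integrable one_le_two).const_mul _]
    simp [integral_const_mul, integral_eval_iidGaussian]
  · rw [integral_map hF.aemeasurable (by fun_prop)]
    simp only [F]
    rw [hcov']
    simp [f]

/-- The linear functional on sequences with finitely many coefficients `a`. -/
noncomputable def linForm (a : ℤ →₀ ℝ) (ω : ℤ → ℝ) : ℝ := a.sum fun n c => c * ω n

@[fun_prop]
lemma measurable_linForm (a : ℤ →₀ ℝ) : Measurable (linForm a) := by
  unfold linForm Finsupp.sum; fun_prop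

lemma linForm_add (a b : ℤ →₀ ℝ) (ω : ℤ → ℝ) : linForm (a + b) ω = linForm a ω + linForm b ω :=
  Finsupp.sum_add_index' (by simp) (by intros; ring)

lemma linForm_neg (a : ℤ →₀ ℝ) (ω : ℤ → ℝ) : linForm (-a) ω = -linForm a ω := by
  simp [linForm, Finsupp.sum_neg_index]

lemma linForm_sub (a b : ℤ →₀ ℝ) (ω : ℤ → ℝ) : linForm (a - b) ω = linForm a ω - linForm b ω := by
  rw [sub_eq_add_neg, linForm_add, linForm_neg, sub_eq_add_neg]

/-- The unitary character of the space of sequences attached to `linForm a`. -/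
noncomputable def seqChar (a : ℤ →₀ ℝ) (ω : ℤ → ℝ) : ℂ := Complex.exp (linForm a ω * Complex.I)

@[fun_prop]
lemma measurable_seqChar (a : ℤ →₀ ℝ) : Measurable (seqChar a) := by
  unfold seqChar; fun_prop

lemma norm_seqChar (a : ℤ →₀ ℝ) (ω : ℤ → ℝ) : ‖seqChar a ω‖ = 1 :=
  Complex.norm_exp_ofReal_mul_I _

lemma seqChar_zero (ω : ℤ → ℝ) : seqChar 0 ω = 1 := by simp [seqChar, linForm]

lemma conj_seqChar_mul (a b : ℤ →₀ ℝ) (ω : ℤ → ℝ) :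
    starRingEnd ℂ (seqChar a ω) * seqChar b ω = seqChar (b - a) ω := by
  rw [seqChar, ← Complex.exp_conj, seqChar, seqChar, ← Complex.exp_add, linForm_sub]
  simp
  ring_nf

/-- A finite measure on sequences is determined by its characteristic function. -/
theorem ext_of_integral_seqChar {μ ν : Measure (ℤ → ℝ)} [IsFiniteMeasure μ] [IsFiniteMeasure ν]
    (h : ∀ a, ∫ ω, seqChar a ω ∂μ = ∫ ω, seqChar a ω ∂ν) : μ = ν := by
  have hrestr : ∀ I : Finset ℤ, ν.map I.restrict = μ.map I.restrict := by
    intro I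
    have hm : Measurable (I.restrict : (ℤ → ℝ) → (I → ℝ)) :=
      measurable_pi_lambda _ fun i => measurable_pi_apply _
    refine Measure.ext_of_charFunDual (funext fun L => ?_)
    rw [charFunDual_apply, charFunDual_apply, integral_map hm.aemeasurable (by fun_prop),
      integral_map hm.aemeasurable (by fun_prop)]
    classical
    let a : ℤ →₀ ℝ := ∑ i : I, Finsupp.single (i : ℤ) (L (Pi.single i 1))
    have ha : ∀ ω : ℤ → ℝ, L (I.restrict ω) = linForm a ω := by
      intro ω
      have h1 : linForm a ω = ∑ i : I, L (Pi.single i 1) * ω i := by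
        simp only [a, linForm]
        rw [← Finsupp.sum_finsetSum_index (by simp) (by intros; ring)]
        simp
      rw [h1]
      conv_lhs => rw [← Finset.univ_sum_single (I.restrict ω)]
      rw [map_sum]
      refine Finset.sum_congr rfl fun i _ => ?_
      have : Pi.single i (I.restrict ω i) = (ω i) • (Pi.single i (1 : ℝ) : I → ℝ) := by
        rw [← Pi.single_smul]; simp
      rw [this, map_smul, smul_eq_mul, mul_comm]
    simp only [ha]
    exact (h a).symm
  exact IsProjectiveLimit.unique (P := fun I => μ.map I.restrict) (fun I => rfl) hrestr

lemma memLp_eval_of_isGaussianProcess {γ : Measure (ℤ → ℝ)}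
    (hγ : IsGaussianProcess (fun (n : ℤ) (ω : ℤ → ℝ) => ω n) γ) (n : ℤ) :
    MemLp (fun ω : ℤ → ℝ => ω n) 2 γ :=
  (hγ.hasGaussianLaw_eval n).memLp_two

lemma hasGaussianLaw_linForm {γ : Measure (ℤ → ℝ)}
    (hγ : IsGaussianProcess (fun (n : ℤ) (ω : ℤ → ℝ) => ω n) γ) (a : ℤ →₀ ℝ) :
    HasGaussianLaw (linForm a) γ := by
  have h := (hγ.hasGaussianLaw a.support).map
    (∑ k : a.support, a k • ContinuousLinearMap.proj (R := ℝ) (φ := fun _ : a.support => ℝ) k)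
  refine h.congr (Eventually.of_forall fun ω => Eq.symm ?_)
  simp only [linForm, Finsupp.sum, Function.comp_apply, sum_apply,
    smul_apply, ContinuousLinearMap.proj_apply, Finset.restrict_def,
    smul_eq_mul]
  exact (Finset.sum_coe_sort a.support fun k => a k * ω k).symm

/-- The bilinear form on coefficients given by the covariance `r (m - n)`. -/
noncomputable def covForm (r : ℤ → ℝ) (a b : ℤ →₀ ℝ) : ℝ :=
  a.sum fun m c => b.sum fun n c' => c * c' * r (m - n)

lemma integral_linForm_mul {γ : Measure (ℤ → ℝ)} {r : ℤ → ℝ}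
    (hγ : IsGaussianProcess (fun (n : ℤ) (ω : ℤ → ℝ) => ω n) γ)
    (hcov : ∀ m n, ∫ ω, ω m * ω n ∂γ = r (m - n)) (a b : ℤ →₀ ℝ) :
    ∫ ω, linForm a ω * linForm b ω ∂γ = covForm r a b := by
  have hint : ∀ k l, Integrable (fun ω : ℤ → ℝ => a k * ω k * (b l * ω l)) γ :=
      fun k l => ((memLp_eval_of_isGaussianProcess hγ k).const_mul _).integrable_mul
        ((memLp_eval_of_isGaussianProcess hγ l).const_mul _)
  simp only [linForm, covForm, Finsupp.sum, Finset.sum_mul_sum]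
  rw [integral_finsetSum _ fun k _ => integrable_finsetSum _ fun l _ => hint k l]
  simp_rw [integral_finsetSum _ fun l _ => hint _ l]
  refine Finset.sum_congr rfl fun k _ => Finset.sum_congr rfl fun l _ => ?_
  rw [← hcov, ← integral_const_mul]
  congr 1; ext ω; ring

lemma integral_seqChar {γ : Measure (ℤ → ℝ)} {r : ℤ → ℝ}
    (hγ : IsGaussianProcess (fun (n : ℤ) (ω : ℤ → ℝ) => ω n) γ)
    (hmean : ∀ n, ∫ ω, ω n ∂γ = 0)
    (hcov : ∀ m n, ∫ ω, ω m * ω n ∂γ = r (m - n)) (a : ℤ →₀ ℝ) :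
    ∫ ω, seqChar a ω ∂γ = Real.exp (-covForm r a a / 2) := by
  have hg := hasGaussianLaw_linForm hγ a
  have hmean' : ∫ ω, linForm a ω ∂γ = 0 := by
    simp only [linForm, Finsupp.sum]
    rw [integral_finsetSum _ fun k _ =>
      ((hγ.hasGaussianLaw_eval k).integrable).const_mul _]
    simp [integral_const_mul, hmean]
  have hvar : Var[linForm a; γ] = covForm r a a := by
    rw [variance_of_integral_eq_zero (by fun_prop) hmean', ← integral_linForm_mul hγ hcov]
    simp_rw [pow_two]
  have hnn : 0 ≤ covForm r a a := hvar ▸ variance_nonneg _ _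
  have h := charFun_gaussianReal (μ := 0) (v := (covForm r a a).toNNReal) 1
  have h2 := hg.map_eq_gaussianReal
  rw [hmean', hvar] at h2
  rw [← h2, charFun_apply_real, integral_map (by fun_prop) (by fun_prop)] at h
  simp only [Complex.ofReal_one, one_mul, Real.coe_toNNReal _ hnn] at h
  simp only [seqChar]
  rw [h]
  push_cast
  congr 1
  ring

/-- Translation of coefficients, dual to the shift. -/
noncomputable def shiftCoeff (m : ℤ) (a : ℤ →₀ ℝ) : ℤ →₀ ℝ :=
  a.mapDomain (· + m)

lemma linForm_shiftCoeff (m : ℤ) (a : ℤ →₀ ℝ) (ω : ℤ → ℝ) :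
    linForm (shiftCoeff m a) ω = linForm a fun n => ω (n + m) := by
  unfold linForm shiftCoeff
  rw [Finsupp.sum_mapDomain_index (by simp) (by intros; ring)]

lemma shiftCoeff_shiftCoeff (m n : ℤ) (a : ℤ →₀ ℝ) :
    shiftCoeff m (shiftCoeff n a) = shiftCoeff (n + m) a := by
  unfold shiftCoeff
  rw [← Finsupp.mapDomain_comp]
  congr 1
  ext k; simp [add_assoc]

lemma covForm_shiftCoeff_right (r : ℤ → ℝ) (m : ℤ) (a b : ℤ →₀ ℝ) :
    covForm r a (shiftCoeff m b) = a.sum fun k c => b.sum fun l c' => c * c' * r (k - l - m) := by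
  unfold covForm shiftCoeff
  refine Finsupp.sum_congr fun k _ => ?_
  rw [Finsupp.sum_mapDomain_index (by simp) (by intros; ring)]
  simp only [sub_sub]

lemma covForm_shiftCoeff_shiftCoeff (r : ℤ → ℝ) (m : ℤ) (a b : ℤ →₀ ℝ) :
    covForm r (shiftCoeff m a) (shiftCoeff m b) = covForm r a b := by
  rw [covForm_shiftCoeff_right]
  unfold covForm shiftCoeff
  rw [Finsupp.sum_mapDomain_index (by simp) (by intros; simp [add_mul, Finsupp.sum_add])]
  refine Finsupp.sum_congr fun k _ => Finsupp.sum_congr fun l _ => ?_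
  rw [show k + m - l - m = k - l by ring]

theorem measurePreserving_seqShift {γ : Measure (ℤ → ℝ)} {r : ℤ → ℝ}
    (hγ : IsGaussianProcess (fun (n : ℤ) (ω : ℤ → ℝ) => ω n) γ)
    (hmean : ∀ n, ∫ ω, ω n ∂γ = 0)
    (hcov : ∀ m n, ∫ ω, ω m * ω n ∂γ = r (m - n)) : MeasurePreserving seqShift γ γ := by
  have := hγ.isProbabilityMeasure
  have := Measure.isProbabilityMeasure_map (μ := γ) seqShift.measurable.aemeasurable
  refine ⟨seqShift.measurable, ext_of_integral_seqChar fun a => ?_⟩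
  rw [integral_map seqShift.measurable.aemeasurable (by fun_prop)]
  have h : ∀ ω, seqChar a (seqShift ω) = seqChar (shiftCoeff 1 a) ω := fun ω => by
    simp only [seqChar, linForm_shiftCoeff]; rfl
  simp only [h]
  rw [integral_seqChar hγ hmean hcov, integral_seqChar hγ hmean hcov,
    covForm_shiftCoeff_shiftCoeff]

/-! ### Characters and the Koopman operator -/

section Density

variable {γ : Measure (ℤ → ℝ)}

lemma integrable_seqChar_mul {f : (ℤ → ℝ) → ℂ} (hf : Integrable f γ) (a : ℤ →₀ ℝ) :
    Integrable (fun ω => seqChar a ω * f ω) γ :=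
  hf.bdd_mul (c := 1) (by fun_prop) (Eventually.of_forall fun ω => (norm_seqChar a ω).le)

/-- A real density orthogonal to all characters vanishes: its positive and negative parts are
densities of two finite measures with the same characteristic function. -/
lemma ae_eq_zero_of_integral_seqChar_mul_ofReal {g : (ℤ → ℝ) → ℝ} (hg : Integrable g γ)
    (h : ∀ a, ∫ ω, seqChar a ω * (g ω : ℂ) ∂γ = 0) : g =ᵐ[γ] 0 := by
  have hpm : AEMeasurable (fun ω => ENNReal.ofReal (g ω)) γ := hg.aemeasurable.ennreal_ofReal
  have hnm : AEMeasurable (fun ω => ENNReal.ofReal (-g ω)) γ := hg.neg.aemeasurable.ennreal_ofReal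
  have hp : ∫⁻ ω, ENNReal.ofReal (g ω) ∂γ ≠ ∞ := hg.lintegral_lt_top.ne
  have hn : ∫⁻ ω, ENNReal.ofReal (-g ω) ∂γ ≠ ∞ := hg.neg.lintegral_lt_top.ne
  have := isFiniteMeasure_withDensity hp
  have := isFiniteMeasure_withDensity hn
  have heq : γ.withDensity (fun ω => ENNReal.ofReal (g ω))
      = γ.withDensity (fun ω => ENNReal.ofReal (-g ω)) := by
    refine ext_of_integral_seqChar fun a => ?_
    rw [integral_withDensity_eq_integral_toReal_smul₀ hpm (by simp),
      integral_withDensity_eq_integral_toReal_smul₀ hnm (by simp), ← sub_eq_zero,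
      ← integral_sub, ← h a]
    · refine integral_congr_ae (Eventually.of_forall fun ω => ?_)
      simp only [ENNReal.toReal_ofReal']
      rw [← sub_smul, max_zero_sub_max_neg_zero_eq_self, Complex.real_smul, mul_comm]
    · exact ((integrable_toReal_of_lintegral_ne_top hpm hp).ofReal (𝕜 := ℂ)
        |> fun hi => (integrable_seqChar_mul hi a).congr (Eventually.of_forall fun ω => by
          simp [mul_comm]))
    · exact ((integrable_toReal_of_lintegral_ne_top hnm hn).ofReal (𝕜 := ℂ)
        |> fun hi => (integrable_seqChar_mul hi a).congr (Eventually.of_forall fun ω => by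
          simp [mul_comm]))
  have h2 := (withDensity_eq_iff hpm hnm hp).1 heq
  filter_upwards [h2] with ω hω
  rcases le_total (g ω) 0 with h0 | h0
  · rw [ENNReal.ofReal_of_nonpos h0, eq_comm, ENNReal.ofReal_eq_zero] at hω
    simp only [Pi.zero_apply]; linarith
  · rw [ENNReal.ofReal_of_nonpos (neg_nonpos.2 h0), ENNReal.ofReal_eq_zero] at hω
    simp only [Pi.zero_apply]; linarith

lemma ae_eq_zero_of_integral_seqChar_mul {f : (ℤ → ℝ) → ℂ} (hf : Integrable f γ)
    (h : ∀ a, ∫ ω, seqChar a ω * f ω ∂γ = 0) : f =ᵐ[γ] 0 := by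
  have hconj : ∀ a, ∫ ω, seqChar a ω * starRingEnd ℂ (f ω) ∂γ = 0 := by
    intro a
    have h1 := h (-a)
    have h2 : ∀ ω, seqChar a ω * starRingEnd ℂ (f ω)
        = starRingEnd ℂ (seqChar (-a) ω * f ω) := by
      intro ω
      rw [map_mul]
      congr 1
      simp [seqChar, linForm_neg, ← Complex.exp_conj]
    simp_rw [h2]
    rw [integral_conj, h1, map_zero]
  have hfc : Integrable (fun ω => starRingEnd ℂ (f ω)) γ :=
    Complex.conjLIE.toContinuousLinearEquiv.integrable_comp_iff.2 hf
  have hre : (fun ω => (f ω).re) =ᵐ[γ] 0 := by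
    refine ae_eq_zero_of_integral_seqChar_mul_ofReal hf.re fun a => ?_
    have h3 : ∀ ω, seqChar a ω * ((f ω).re : ℂ)
        = (1 / 2) * (seqChar a ω * f ω + seqChar a ω * starRingEnd ℂ (f ω)) := by
      intro ω
      rw [← mul_add, Complex.add_conj]; push_cast; ring
    simp_rw [h3]
    rw [integral_const_mul, integral_add (integrable_seqChar_mul hf a)
      (integrable_seqChar_mul hfc a), h, hconj]
    simp
  have him : (fun ω => (f ω).im) =ᵐ[γ] 0 := by
    refine ae_eq_zero_of_integral_seqChar_mul_ofReal hf.im fun a => ?_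
    have h3 : ∀ ω, seqChar a ω * ((f ω).im : ℂ)
        = (1 / (2 * Complex.I)) * (seqChar a ω * f ω - seqChar a ω * starRingEnd ℂ (f ω)) := by
      intro ω
      rw [← mul_sub, Complex.sub_conj]; push_cast
      field_simp
    simp_rw [h3]
    rw [integral_const_mul, integral_sub (integrable_seqChar_mul hf a)
      (integrable_seqChar_mul hfc a), h, hconj]
    simp
  filter_upwards [hre, him] with ω h1 h2
  exact Complex.ext h1 h2

variable [IsProbabilityMeasure γ]

variable (γ) in
/-- The character `seqChar a` as an element of `L²(γ)`. -/
noncomputable def charLp (a : ℤ →₀ ℝ) : Lp ℂ 2 γ :=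
  (MemLp.of_bound (by fun_prop) 1
    (Eventually.of_forall fun ω => (norm_seqChar a ω).le) : MemLp (seqChar a) 2 γ).toLp

lemma coeFn_charLp (a : ℤ →₀ ℝ) : charLp γ a =ᵐ[γ] seqChar a := MemLp.coeFn_toLp _

lemma inner_charLp (a : ℤ →₀ ℝ) (f : Lp ℂ 2 γ) :
    inner ℂ (charLp γ a) f = ∫ ω, seqChar (-a) ω * f ω ∂γ := by
  rw [L2.inner_def]
  refine integral_congr_ae ?_
  filter_upwards [coeFn_charLp (γ := γ) a] with ω hω
  rw [hω, RCLike.inner_apply, mul_comm]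
  congr 1
  simp [seqChar, linForm_neg, ← Complex.exp_conj]

lemma inner_charLp_charLp (a b : ℤ →₀ ℝ) :
    inner ℂ (charLp γ a) (charLp γ b) = ∫ ω, seqChar (b - a) ω ∂γ := by
  rw [inner_charLp]
  refine integral_congr_ae ?_
  filter_upwards [coeFn_charLp (γ := γ) b] with ω hω
  rw [hω, ← conj_seqChar_mul]
  congr 1
  simp [seqChar, linForm_neg, ← Complex.exp_conj]

lemma norm_charLp (a : ℤ →₀ ℝ) : ‖charLp γ a‖ = 1 := by
  have h : inner ℂ (charLp γ a) (charLp γ a) = 1 := by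
    rw [inner_charLp_charLp]; simp [seqChar_zero]
  have h2 : ‖charLp γ a‖ ^ 2 = 1 := by rw [← inner_self_eq_norm_sq (𝕜 := ℂ), h]; simp
  exact (pow_eq_one_iff_of_nonneg (norm_nonneg _) two_ne_zero).1 h2

theorem span_charLp_dense :
    (Submodule.span ℂ (Set.range (charLp γ))).topologicalClosure = ⊤ := by
  rw [Submodule.topologicalClosure_eq_top_iff, Submodule.eq_bot_iff]
  intro f hf
  rw [Submodule.mem_orthogonal] at hf
  rw [Lp.eq_zero_iff_ae_eq_zero]
  refine ae_eq_zero_of_integral_seqChar_mul ((Lp.memLp f).integrable one_le_two) fun a => ?_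
  have := hf _ (Submodule.subset_span ⟨-a, rfl⟩)
  rwa [inner_charLp, neg_neg] at this

end Density

/-- Pointwise convergence to zero of a uniformly bounded sequence of linear maps may be checked on
a set spanning a dense subspace. -/
lemma tendsto_zero_of_dense_span {E F : Type*} [NormedAddCommGroup E] [NormedSpace ℂ E]
    [NormedAddCommGroup F] [NormedSpace ℂ F] (A : ℕ → E →ₗ[ℂ] F) (C : ℝ)
    (hA : ∀ k x, ‖A k x‖ ≤ C * ‖x‖) (s : Set E)
    (hs : (Submodule.span ℂ s).topologicalClosure = ⊤)
    (h : ∀ x ∈ s, Tendsto (fun k => A k x) atTop (𝓝 0)) (x : E) :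
    Tendsto (fun k => A k x) atTop (𝓝 0) := by
  have hspan : ∀ y ∈ Submodule.span ℂ s, Tendsto (fun k => A k y) atTop (𝓝 0) := by
    intro y hy
    induction hy using Submodule.span_induction with
    | mem y hy => exact h y hy
    | zero => simp
    | add y z _ _ hy hz => simpa using hy.add hz
    | smul c y _ hy => simpa using hy.const_smul c
  have hx : x ∈ closure (Submodule.span ℂ s : Set E) := by
    rw [← Submodule.topologicalClosure_coe, hs]; trivial
  rw [Metric.tendsto_atTop]
  intro ε hε
  obtain ⟨y, hy, hxy⟩ := Metric.mem_closure_iff.1 hx (ε / (2 * (|C| + 1))) (by positivity)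
  obtain ⟨K, hK⟩ := Metric.tendsto_atTop.1 (hspan y hy) (ε / 2) (by positivity)
  refine ⟨K, fun k hk => ?_⟩
  have h1 := hK k hk
  rw [dist_zero_right] at h1 ⊢
  rw [dist_eq_norm, lt_div_iff₀ (by positivity)] at hxy
  have h2 := hA k (x - y)
  have h3 : ‖A k x‖ ≤ ‖A k (x - y)‖ + ‖A k y‖ := by
    have := norm_add_le (A k (x - y)) (A k y)
    rwa [← map_add, sub_add_cancel] at this
  have h4 : C * ‖x - y‖ ≤ |C| * ‖x - y‖ := by gcongr; exact le_abs_self C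
  nlinarith [norm_nonneg (x - y)]

section Koopman

variable {γ : Measure (ℤ → ℝ)} [IsProbabilityMeasure γ] (hT : MeasurePreserving seqShift γ γ)

lemma koopman_charLp (a : ℤ →₀ ℝ) : koopman hT (charLp γ a) = charLp γ (shiftCoeff 1 a) := by
  have h : seqChar a ∘ seqShift = seqChar (shiftCoeff 1 a) := by
    funext ω
    simp only [Function.comp_apply, seqChar, linForm_shiftCoeff]; rfl
  unfold charLp
  refine (Lp.toLp_compMeasurePreserving _ hT).trans ?_
  exact MemLp.toLp_congr _ _ (Eventually.of_forall fun ω => congrFun h ω)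

lemma koopman_pow_charLp (n : ℕ) (a : ℤ →₀ ℝ) :
    (koopman hT ^ n) (charLp γ a) = charLp γ (shiftCoeff n a) := by
  induction n with
  | zero =>
    have : shiftCoeff ((0 : ℕ) : ℤ) a = a := by
      simp only [shiftCoeff, Nat.cast_zero, add_zero]
      exact Finsupp.mapDomain_id
    rw [this]; rfl
  | succ n ih =>
    rw [pow_succ']
    change koopman hT ((koopman hT ^ n) (charLp γ a)) = _
    rw [ih, koopman_charLp, shiftCoeff_shiftCoeff]
    push_cast; rfl

lemma charLp_zero_smul (c : ℂ) : c • charLp γ 0 = Lp.const 2 γ c := by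
  refine Lp.ext ?_
  filter_upwards [Lp.coeFn_smul c (charLp γ 0), coeFn_charLp (γ := γ) 0,
    Lp.coeFn_const (p := 2) (μ := γ) c] with ω h1 h2 h3
  rw [h1, h3, Pi.smul_apply, h2, seqChar_zero]
  simp

end Koopman

section Covariance

lemma covForm_sub_left (r : ℤ → ℝ) (a b c : ℤ →₀ ℝ) :
    covForm r (a - b) c = covForm r a c - covForm r b c := by
  unfold covForm
  rw [Finsupp.sum_sub_index]
  intro k x y
  simp only [sub_mul, Finsupp.sum_sub]

lemma covForm_sub_right (r : ℤ → ℝ) (a b c : ℤ →₀ ℝ) :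
    covForm r a (b - c) = covForm r a b - covForm r a c := by
  unfold covForm
  rw [← Finsupp.sum_sub]
  refine Finsupp.sum_congr fun k _ => ?_
  rw [Finsupp.sum_sub_index]
  intro k x y
  ring

lemma covForm_comm (r : ℤ → ℝ) (hr : ∀ n, r (-n) = r n) (a b : ℤ →₀ ℝ) :
    covForm r a b = covForm r b a := by
  unfold covForm Finsupp.sum
  rw [Finset.sum_comm]
  refine Finset.sum_congr rfl fun k _ => Finset.sum_congr rfl fun l _ => ?_
  change a l * b k * r (l - k) = b k * a l * r (k - l)
  rw [← hr (k - l), neg_sub]; ring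

lemma tendsto_covForm_shiftCoeff {r s : ℤ → ℝ} (hr : ∀ n, r (-n) = r n) (hs : ∀ n, s (-n) = s n)
    {N : ℕ → ℕ} (h : ∀ j : ℤ, Tendsto (fun t => r (N t + j)) atTop (𝓝 (s j))) (a b : ℤ →₀ ℝ) :
    Tendsto (fun t => covForm r a (shiftCoeff (N t) b)) atTop (𝓝 (covForm s a b)) := by
  simp only [covForm_shiftCoeff_right]
  unfold covForm Finsupp.sum
  refine tendsto_finsetSum _ fun k _ => tendsto_finsetSum _ fun l _ => ?_
  refine Tendsto.const_mul _ ?_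
  rw [← hs, neg_sub]
  refine (h (l - k)).congr fun t => ?_
  rw [← hr]; congr 1; ring

end Covariance

section Dynamics

variable {γ : Measure (ℤ → ℝ)} {r : ℤ → ℝ}

lemma inner_charLp_shiftCoeff [IsProbabilityMeasure γ]
    (hγ : IsGaussianProcess (fun (n : ℤ) (ω : ℤ → ℝ) => ω n) γ)
    (hmean : ∀ n, ∫ ω, ω n ∂γ = 0) (hcov : ∀ m n, ∫ ω, ω m * ω n ∂γ = r (m - n))
    (hr : ∀ n, r (-n) = r n) (a b : ℤ →₀ ℝ) (m : ℤ) :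
    inner ℂ (charLp γ a) (charLp γ (shiftCoeff m b)) =
      (Real.exp (-(covForm r b b + covForm r a a - 2 * covForm r a (shiftCoeff m b)) / 2) : ℂ) := by
  rw [inner_charLp_charLp, integral_seqChar hγ hmean hcov, covForm_sub_left, covForm_sub_right,
    covForm_sub_right, covForm_shiftCoeff_shiftCoeff, covForm_comm r hr (shiftCoeff m b) a]
  congr 3
  ring

/-- If the covariances return to their initial values along a sequence of times, then the Koopman
operators at these times converge to the identity. -/
theorem isRigid_of_tendsto_covariance [IsProbabilityMeasure γ]
    (hT : MeasurePreserving seqShift γ γ)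
    (hγ : IsGaussianProcess (fun (n : ℤ) (ω : ℤ → ℝ) => ω n) γ)
    (hmean : ∀ n, ∫ ω, ω n ∂γ = 0) (hcov : ∀ m n, ∫ ω, ω m * ω n ∂γ = r (m - n))
    (hr : ∀ n, r (-n) = r n) (N : ℕ → ℕ) (hN : StrictMono N)
    (h : ∀ j : ℤ, Tendsto (fun t => r (N t + j)) atTop (𝓝 (r j))) : IsRigid hT := by
  intro f
  refine ⟨N, hN, ?_⟩
  rw [← tendsto_sub_nhds_zero_iff]
  refine tendsto_zero_of_dense_span (fun k => (koopman hT ^ N k).toLinearMap - LinearMap.id) 2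
    (fun k x => ?_) _ span_charLp_dense ?_ f
  · refine (norm_sub_le _ _).trans ?_
    simp only [LinearIsometry.coe_toLinearMap, LinearIsometry.norm_map, LinearMap.id_apply]
    linarith
  · rintro _ ⟨a, rfl⟩
    simp only [LinearMap.sub_apply, LinearIsometry.coe_toLinearMap, LinearMap.id_apply,
      koopman_pow_charLp]
    rw [tendsto_zero_iff_norm_tendsto_zero]
    have hsq : Tendsto (fun k => ‖charLp γ (shiftCoeff (N k) a) - charLp γ a‖ ^ 2) atTop
        (𝓝 0) := by
      have h1 : ∀ k, ‖charLp γ (shiftCoeff (N k) a) - charLp γ a‖ ^ 2 = 2 - 2 *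
          Real.exp (-(covForm r a a + covForm r a a
            - 2 * covForm r a (shiftCoeff (N k) a)) / 2) := by
        intro k
        rw [norm_sub_rev, norm_sub_sq (𝕜 := ℂ), norm_charLp, norm_charLp,
          inner_charLp_shiftCoeff hγ hmean hcov hr]
        rw [RCLike.re_to_complex, Complex.ofReal_re]
        ring
      simp only [h1]
      have h2 := tendsto_covForm_shiftCoeff hr hr h a a
      have h3 : Tendsto (fun k => 2 - 2 * Real.exp (-(covForm r a a + covForm r a a
            - 2 * covForm r a (shiftCoeff (N k) a)) / 2)) atTop
          (𝓝 (2 - 2 * Real.exp (-(covForm r a a + covForm r a a - 2 * covForm r a a) / 2))) :=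
        tendsto_const_nhds.sub ((Real.continuous_exp.tendsto _).comp
          ((tendsto_const_nhds.sub (h2.const_mul 2)).neg.div_const 2) |>.const_mul 2)
      convert h3 using 2
      rw [show -(covForm r a a + covForm r a a - 2 * covForm r a a) / 2 = 0 by ring]
      simp
    have := hsq.sqrt
    simpa using this

/-- If the covariances vanish along a sequence of times and along each of its translates, then the
Koopman operators at these times converge weakly to the projection on constants. -/
theorem tendsto_inner_koopman_pow [IsProbabilityMeasure γ]
    (hT : MeasurePreserving seqShift γ γ)
    (hγ : IsGaussianProcess (fun (n : ℤ) (ω : ℤ → ℝ) => ω n) γ)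
    (hmean : ∀ n, ∫ ω, ω n ∂γ = 0) (hcov : ∀ m n, ∫ ω, ω m * ω n ∂γ = r (m - n))
    (hr : ∀ n, r (-n) = r n) (N : ℕ → ℕ)
    (h : ∀ j : ℤ, Tendsto (fun t => r (N t + j)) atTop (𝓝 0)) (f g : Lp ℂ 2 γ) :
    Tendsto (fun k => inner ℂ g ((koopman hT ^ N k) f)
      - inner ℂ g (charLp γ 0) * inner ℂ (charLp γ 0) f) atTop (𝓝 0) := by
  have hbound : ∀ k (f g : Lp ℂ 2 γ), ‖inner ℂ g ((koopman hT ^ N k) f)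
      - inner ℂ g (charLp γ 0) * inner ℂ (charLp γ 0) f‖ ≤ 2 * ‖g‖ * ‖f‖ := by
    intro k f g
    have h1 := norm_inner_le_norm (𝕜 := ℂ) g ((koopman hT ^ N k) f)
    have h2 := norm_inner_le_norm (𝕜 := ℂ) g (charLp γ 0)
    have h3 := norm_inner_le_norm (𝕜 := ℂ) (charLp γ 0) f
    rw [LinearIsometry.norm_map] at h1
    rw [norm_charLp, mul_one] at h2
    rw [norm_charLp, one_mul] at h3
    refine (norm_sub_le _ _).trans ?_
    rw [norm_mul]
    have := mul_le_mul h2 h3 (norm_nonneg _) (norm_nonneg _)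
    linarith
  -- on characters this is a computation with characteristic functions
  have hchar : ∀ a b, Tendsto (fun k => inner ℂ (charLp γ a) ((koopman hT ^ N k) (charLp γ b))
      - inner ℂ (charLp γ a) (charLp γ 0) * inner ℂ (charLp γ 0) (charLp γ b)) atTop (𝓝 0) := by
    intro a b
    rw [tendsto_sub_nhds_zero_iff]
    simp only [koopman_pow_charLp]
    rw [inner_charLp_charLp, inner_charLp_charLp, integral_seqChar hγ hmean hcov,
      integral_seqChar hγ hmean hcov]
    simp only [inner_charLp_shiftCoeff hγ hmean hcov hr]
    have h2 := tendsto_covForm_shiftCoeff hr (s := 0) (by simp) h a b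
    have h0 : covForm 0 a b = 0 := by simp [covForm]
    rw [h0] at h2
    have h3 : Tendsto (fun k => Real.exp (-(covForm r b b + covForm r a a
            - 2 * covForm r a (shiftCoeff (N k) b)) / 2)) atTop
          (𝓝 (Real.exp (-(covForm r b b + covForm r a a - 2 * 0) / 2))) :=
        (Real.continuous_exp.tendsto _).comp
          ((tendsto_const_nhds.sub (h2.const_mul 2)).neg.div_const 2)
    have h4 := (Complex.continuous_ofReal.tendsto _).comp h3
    convert h4 using 2
    · rfl
    rw [← Complex.ofReal_mul, ← Real.exp_add]
    congr 2
    have hneg : covForm r (0 - a) (0 - a) = covForm r a a := by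
      rw [covForm_sub_left, covForm_sub_right, covForm_sub_right]
      simp [covForm]
    rw [hneg, sub_zero]
    ring
  have hstep : ∀ a f, Tendsto (fun k => inner ℂ (charLp γ a) ((koopman hT ^ N k) f)
      - inner ℂ (charLp γ a) (charLp γ 0) * inner ℂ (charLp γ 0) f) atTop (𝓝 0) := by
    intro a f
    refine tendsto_zero_of_dense_span (fun k => (innerₛₗ ℂ (charLp γ a)) ∘ₗ
      (koopman hT ^ N k).toLinearMap - (inner ℂ (charLp γ a) (charLp γ 0)) •
        innerₛₗ ℂ (charLp γ 0)) 2 (fun k x => ?_) _ span_charLp_dense ?_ f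
    · have := hbound k x (charLp γ a)
      rwa [norm_charLp, mul_one] at this
    · rintro _ ⟨b, rfl⟩
      exact hchar a b
  -- the inner product is antilinear in `g`, so the second density argument is applied to conjugates
  have hconj := tendsto_zero_of_dense_span (fun k => innerₛₗ ℂ ((koopman hT ^ N k) f)
      - (inner ℂ f (charLp γ 0)) • innerₛₗ ℂ (charLp γ 0)) (2 * ‖f‖) (fun k x => ?_) _
      span_charLp_dense ?_ g
  · have h5 := (Complex.continuous_conj.tendsto 0).comp hconj
    rw [map_zero] at h5
    refine h5.congr fun k => ?_
    simp [mul_comm]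
  · have h6 := hbound k f x
    rw [← Complex.norm_conj] at h6
    refine le_trans (le_of_eq ?_) (h6.trans_eq (by ring))
    simp [mul_comm]
  · rintro _ ⟨a, rfl⟩
    have h5 := (Complex.continuous_conj.tendsto 0).comp (hstep a f)
    rw [map_zero] at h5
    refine h5.congr fun k => ?_
    simp [mul_comm]

/-- If `f` is an eigenvector, then `|⟪f, Tᴺ f⟫| = ‖f‖²` for all `N`, while along the mixing times
the limit is `|⟪1, f⟫|²`; by the equality case of Cauchy–Schwarz `f` is constant. -/
theorem isWeaklyMixing_of_tendsto_covariance [IsProbabilityMeasure γ]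
    (hT : MeasurePreserving seqShift γ γ)
    (hγ : IsGaussianProcess (fun (n : ℤ) (ω : ℤ → ℝ) => ω n) γ)
    (hmean : ∀ n, ∫ ω, ω n ∂γ = 0) (hcov : ∀ m n, ∫ ω, ω m * ω n ∂γ = r (m - n))
    (hr : ∀ n, r (-n) = r n) (N : ℕ → ℕ)
    (h : ∀ j : ℤ, Tendsto (fun t => r (N t + j)) atTop (𝓝 0)) : IsWeaklyMixing hT := by
  intro z f hf
  have hfz : koopman hT f = z • f := hf.apply_eq_smul
  have hf0 : f ≠ 0 := hf.2
  have hz : ‖z‖ = 1 := by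
    have h1 := congrArg norm hfz
    rw [LinearIsometry.norm_map, norm_smul] at h1
    exact (mul_right_cancel₀ (norm_ne_zero_iff.2 hf0) (by rw [one_mul]; exact h1)).symm
  have hpow : ∀ n : ℕ, (koopman hT ^ n) f = z ^ n • f := by
    intro n
    induction n with
    | zero => simp
    | succ n ih =>
      rw [pow_succ']
      change koopman hT ((koopman hT ^ n) f) = _
      rw [ih, map_smul, hfz, smul_smul, pow_succ]
  have hlim := tendsto_inner_koopman_pow hT hγ hmean hcov hr N h f f
  rw [tendsto_sub_nhds_zero_iff] at hlim
  have hlim2 := hlim.norm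
  have hconst : ∀ k, ‖inner ℂ f ((koopman hT ^ N k) f)‖ = ‖f‖ ^ 2 := by
    intro k
    rw [hpow, inner_smul_right, norm_mul, norm_pow, hz, one_pow, one_mul,
      inner_self_eq_norm_sq_to_K]
    simp
  simp only [hconst] at hlim2
  have heq := tendsto_nhds_unique tendsto_const_nhds hlim2
  rw [norm_mul, norm_inner_symm, ← pow_two] at heq
  refine ⟨inner ℂ (charLp γ 0) f, ?_⟩
  -- `‖f - ⟪1, f⟫ 1‖² = ‖f‖² - |⟪1, f⟫|²`
  rw [← charLp_zero_smul, ← sub_eq_zero, ← norm_eq_zero, ← sq_eq_zero_iff,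
    norm_sub_sq (𝕜 := ℂ), norm_smul, norm_charLp, inner_smul_right, heq, ← inner_conj_symm f,
    RCLike.mul_conj]
  simp only [mul_one]
  norm_cast
  ring

end Dynamics

/-! ### Quadrants and half-spaces -/

/-- A finite measure on the plane is determined by its characteristic function. -/
lemma ext_of_integral_exp_prod {μ ν : Measure (ℝ × ℝ)} [IsFiniteMeasure μ] [IsFiniteMeasure ν]
    (h : ∀ s t : ℝ, ∫ z, Complex.exp (((s * z.1 + t * z.2 : ℝ) : ℂ) * Complex.I) ∂μ =
      ∫ z, Complex.exp (((s * z.1 + t * z.2 : ℝ) : ℂ) * Complex.I) ∂ν) : μ = ν := by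
  refine Measure.ext_of_charFunDual (funext fun L => ?_)
  have hL : ∀ z : ℝ × ℝ, L z = L (1, 0) * z.1 + L (0, 1) * z.2 := by
    intro z
    have : z = z.1 • ((1 : ℝ), (0 : ℝ)) + z.2 • ((0 : ℝ), (1 : ℝ)) := by ext <;> simp
    conv_lhs => rw [this]
    rw [map_add, map_smul, map_smul, smul_eq_mul, smul_eq_mul]
    ring
  have hfun : (fun z => Complex.exp ((L z : ℂ) * Complex.I)) = fun z : ℝ × ℝ =>
      Complex.exp (((L (1, 0) * z.1 + L (0, 1) * z.2 : ℝ) : ℂ) * Complex.I) :=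
    funext fun z => by rw [hL z]
  rw [charFunDual_apply, charFunDual_apply, hfun]
  exact h _ _

/-- The law of a pair of standard Gaussian variables with correlation `c`. -/
noncomputable def pairLaw (c : ℝ) : Measure (ℝ × ℝ) :=
  ((gaussianReal 0 1).prod (gaussianReal 0 1)).map
    fun z => (z.1, c * z.1 + √(1 - c ^ 2) * z.2)

lemma measurable_pairLaw_map (c : ℝ) :
    Measurable fun z : ℝ × ℝ => (z.1, c * z.1 + √(1 - c ^ 2) * z.2) := by fun_prop

instance (c : ℝ) : IsProbabilityMeasure (pairLaw c) :=
  Measure.isProbabilityMeasure_map (measurable_pairLaw_map c).aemeasurable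

lemma integral_exp_pairLaw (c : ℝ) (hc : |c| ≤ 1) (s t : ℝ) :
    ∫ z, Complex.exp (((s * z.1 + t * z.2 : ℝ) : ℂ) * Complex.I) ∂(pairLaw c) =
      Real.exp (-(s ^ 2 + t ^ 2 + 2 * s * t * c) / 2) := by
  rw [pairLaw, integral_map (measurable_pairLaw_map c).aemeasurable (by fun_prop)]
  have h : ∀ z : ℝ × ℝ, Complex.exp (((s * z.1 + t * (c * z.1 + √(1 - c ^ 2) * z.2) : ℝ) : ℂ)
      * Complex.I) = Complex.exp (((s + t * c : ℝ) : ℂ) * z.1 * Complex.I) *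
        Complex.exp (((t * √(1 - c ^ 2) : ℝ) : ℂ) * z.2 * Complex.I) := by
    intro z
    rw [← Complex.exp_add]
    push_cast
    congr 1
    ring
  simp only [h]
  rw [integral_prod_mul (fun x : ℝ => Complex.exp (((s + t * c : ℝ) : ℂ) * x * Complex.I))
    (fun x : ℝ => Complex.exp (((t * √(1 - c ^ 2) : ℝ) : ℂ) * x * Complex.I)),
    ← charFun_apply_real, ← charFun_apply_real, charFun_gaussianReal, charFun_gaussianReal,
    ← Complex.exp_add, Complex.ofReal_exp]
  congr 1
  have hsq : √(1 - c ^ 2) ^ 2 = 1 - c ^ 2 := Real.sq_sqrt (by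
    have := sq_le_one_iff_abs_le_one c |>.2 hc
    linarith)
  have hsq' : ((√(1 - c ^ 2) : ℝ) : ℂ) ^ 2 = 1 - (c : ℂ) ^ 2 := by exact_mod_cast hsq
  push_cast
  rw [mul_pow, hsq']
  ring

/-- The open first quadrant. -/
def quadrant : Set (ℝ × ℝ) := {z | 0 < z.1 ∧ 0 < z.2}

lemma measurableSet_quadrant : MeasurableSet quadrant :=
  (measurableSet_lt measurable_const measurable_fst).inter
    (measurableSet_lt measurable_const measurable_snd)

/-- For correlation `-1/2` the three variables `x`, `y`, `-x-y` are exchangeable and symmetric, so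
the six sign patterns available to three numbers with sum zero are equally likely. -/
lemma pairLaw_neg_half_quadrant_le : (pairLaw (-(1 / 2))).real quadrant ≤ 1 / 6 := by
  set ν := pairLaw (-(1 / 2)) with hν
  have hc : |(-(1 / 2) : ℝ)| ≤ 1 := by rw [abs_le]; norm_num
  have hexp := integral_exp_pairLaw _ hc
  -- a linear map preserves the law as soon as it preserves the quadratic form of the exponent
  have inv : ∀ M : ℝ × ℝ → ℝ × ℝ, Measurable M → (∀ s t : ℝ, ∃ s' t' : ℝ,
      (∀ z, s * (M z).1 + t * (M z).2 = s' * z.1 + t' * z.2) ∧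
        s' ^ 2 + t' ^ 2 - s' * t' = s ^ 2 + t ^ 2 - s * t) →
      MeasurePreserving M ν ν := by
    intro M hM h
    have := Measure.isProbabilityMeasure_map (μ := ν) hM.aemeasurable
    refine ⟨hM, ext_of_integral_exp_prod fun s t => ?_⟩
    rw [integral_map hM.aemeasurable (by fun_prop)]
    obtain ⟨s', t', h1, h2⟩ := h s t
    simp only [h1]
    rw [hexp, hexp]
    congr 2
    linarith
  have hrot : MeasurePreserving (fun z : ℝ × ℝ => (z.2, -z.1 - z.2)) ν ν :=
    inv _ (by fun_prop) fun s t => ⟨-t, s - t, fun z => by ring, by ring⟩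
  have hneg : MeasurePreserving (fun z : ℝ × ℝ => (-z.1, -z.2)) ν ν :=
    inv _ (by fun_prop) fun s t => ⟨-s, -t, fun z => by ring, by ring⟩
  have hrot2 := hrot.comp hrot
  set E := quadrant with hE
  set E1 := (fun z : ℝ × ℝ => (z.2, -z.1 - z.2)) ⁻¹' E with hE1
  set E2 := ((fun z : ℝ × ℝ => (z.2, -z.1 - z.2)) ∘ fun z : ℝ × ℝ => (z.2, -z.1 - z.2)) ⁻¹' E
    with hE2
  have m0 : MeasurableSet E := measurableSet_quadrant
  have m1 : MeasurableSet E1 := hrot.measurable m0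
  have m2 : MeasurableSet E2 := hrot2.measurable m0
  have e1 : ν.real E1 = ν.real E := hrot.measureReal_preimage m0.nullMeasurableSet
  have e2 : ν.real E2 = ν.real E := hrot2.measureReal_preimage m0.nullMeasurableSet
  have d1 : Disjoint E E1 := by
    rw [Set.disjoint_left]
    rintro z ⟨h1, h2⟩ ⟨h3, h4⟩
    simp only at h3 h4
    linarith
  have d2 : Disjoint (E ∪ E1) E2 := by
    rw [Set.disjoint_left]
    rintro z (⟨h1, h2⟩ | ⟨h1, h2⟩) ⟨h3, h4⟩ <;> simp only [Function.comp_apply] at * <;> linarith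
  -- three sign patterns with two positive entries and their opposites: six disjoint sets
  set D := (E ∪ E1) ∪ E2 with hD
  have mD : MeasurableSet D := (m0.union m1).union m2
  have hDr : ν.real D = 3 * ν.real E := by
    rw [hD, measureReal_union d2 m2, measureReal_union d1 m1, e1, e2]; ring
  have hDn : ν.real ((fun z : ℝ × ℝ => (-z.1, -z.2)) ⁻¹' D) = 3 * ν.real E := by
    rw [hneg.measureReal_preimage mD.nullMeasurableSet, hDr]
  have d3 : Disjoint D ((fun z : ℝ × ℝ => (-z.1, -z.2)) ⁻¹' D) := by
    rw [Set.disjoint_left]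
    rintro z ((⟨h1, h2⟩ | ⟨h1, h2⟩) | ⟨h1, h2⟩) ((⟨h3, h4⟩ | ⟨h3, h4⟩) | ⟨h3, h4⟩) <;>
      simp only [Function.comp_apply] at * <;> linarith
  have htot := measureReal_union (μ := ν) d3 (hneg.measurable mD)
  have hle : ν.real (D ∪ (fun z : ℝ × ℝ => (-z.1, -z.2)) ⁻¹' D) ≤ 1 := measureReal_le_one
  rw [hDr, hDn] at htot
  linarith

lemma pairLaw_real_quadrant (c : ℝ) : (pairLaw c).real quadrant =
    ((gaussianReal 0 1).prod (gaussianReal 0 1)).real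
      {z : ℝ × ℝ | 0 < z.1 ∧ 0 < c * z.1 + √(1 - c ^ 2) * z.2} := by
  rw [pairLaw, map_measureReal_apply (measurable_pairLaw_map c) measurableSet_quadrant]
  rfl

lemma continuousAt_pairLaw_quadrant :
    ContinuousAt (fun c => (pairLaw c).real quadrant) (-(1 / 2)) := by
  simp only [ContinuousAt, pairLaw_real_quadrant]
  simp only [measureReal_def]
  refine (ENNReal.tendsto_toReal (measure_ne_top _ _)).comp ?_
  have hmeas : ∀ c : ℝ, MeasurableSet {z : ℝ × ℝ | 0 < z.1 ∧ 0 < c * z.1 + √(1 - c ^ 2) * z.2} :=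
    fun c => measurable_pairLaw_map c measurableSet_quadrant
  have hs : √(1 - (-(1 / 2) : ℝ) ^ 2) ≠ 0 := by
    rw [Real.sqrt_ne_zero']; norm_num
  -- the degenerate line has measure zero since its vertical sections are points
  have hline : ∀ᵐ z ∂((gaussianReal 0 1).prod (gaussianReal 0 1)),
      (-(1 / 2)) * z.1 + √(1 - (-(1 / 2) : ℝ) ^ 2) * z.2 ≠ 0 := by
    rw [Measure.ae_prod_iff_ae_ae]
    · refine Eventually.of_forall fun x => ?_
      have : NullSingletonClass (gaussianReal 0 1) := nullSingletonClass_gaussianReal one_ne_zero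
      have h0 := measure_singleton (μ := gaussianReal 0 1)
        (x / 2 / √(1 - (-(1 / 2) : ℝ) ^ 2))
      rw [ae_iff]
      refine measure_mono_null (fun y hy => ?_) h0
      simp only [ne_eq, not_not, Set.mem_ofPred_eq] at hy
      rw [Set.mem_singleton_iff, eq_div_iff hs]
      linarith
    · exact (measurableSet_eq_fun (by fun_prop) (by fun_prop)).compl
  refine tendsto_measure_of_ae_tendsto_indicator _ (hmeas _) hmeas MeasurableSet.univ
    (measure_ne_top _ _) (Eventually.of_forall fun _ => Set.subset_univ _) ?_
  filter_upwards [hline] with z hz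
  have hcont : Continuous fun c : ℝ => c * z.1 + √(1 - c ^ 2) * z.2 := by fun_prop
  rcases lt_or_gt_of_ne hz with h | h
  · filter_upwards [hcont.continuousAt.eventually_lt continuousAt_const h] with c hc
    exact ⟨fun h1 => absurd h1.2 (not_lt.2 hc.le), fun h1 => absurd h1.2 (not_lt.2 h.le)⟩
  · filter_upwards [continuousAt_const.eventually_lt hcont.continuousAt h] with c hc
    exact ⟨fun h1 => ⟨h1.1, h⟩, fun h1 => ⟨h1.1, hc⟩⟩

lemma exists_quadrant_lt (ε : ℝ) (hε : 0 < ε) :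
    ∃ δ > 0, ∀ c : ℝ, |c + 1 / 2| < δ → (pairLaw c).real quadrant < 1 / 6 + ε := by
  have h := Metric.eventually_nhds_iff.1 (continuousAt_pairLaw_quadrant.eventually_lt
    (continuousAt_const (y := 1 / 6 + ε))
    (pairLaw_neg_half_quadrant_le.trans_lt (by linarith)))
  obtain ⟨δ, hδ, h⟩ := h
  refine ⟨δ, hδ, fun c hc => h ?_⟩
  rwa [Real.dist_eq, sub_neg_eq_add]

lemma covForm_single_single (r : ℤ → ℝ) (m n : ℤ) (s t : ℝ) :
    covForm r (Finsupp.single m s) (Finsupp.single n t) = s * t * r (m - n) := by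
  simp [covForm]

section System

variable {γ : Measure (ℤ → ℝ)} {r : ℤ → ℝ}

lemma map_pair_eq_pairLaw
    (hγ : IsGaussianProcess (fun (n : ℤ) (ω : ℤ → ℝ) => ω n) γ)
    (hmean : ∀ n, ∫ ω, ω n ∂γ = 0) (hcov : ∀ m n, ∫ ω, ω m * ω n ∂γ = r (m - n))
    (hr : ∀ n, r (-n) = r n) (hr0 : r 0 = 1) (m : ℤ) (hm : |r m| ≤ 1) :
    γ.map (fun ω => (ω 0, ω m)) = pairLaw (r m) := by
  have := hγ.isProbabilityMeasure
  have hmeas : Measurable fun ω : ℤ → ℝ => (ω 0, ω m) :=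
    (measurable_pi_apply 0).prodMk (measurable_pi_apply m)
  have := Measure.isProbabilityMeasure_map (μ := γ) hmeas.aemeasurable
  refine ext_of_integral_exp_prod fun s t => ?_
  rw [integral_exp_pairLaw _ hm, integral_map hmeas.aemeasurable (by fun_prop)]
  have h := integral_seqChar hγ hmean hcov (Finsupp.single 0 s - Finsupp.single m (-t))
  have hlin : ∀ ω, seqChar (Finsupp.single 0 s - Finsupp.single m (-t)) ω
      = Complex.exp (((s * ω 0 + t * ω m : ℝ) : ℂ) * Complex.I) := by
    intro ω
    have h1 : linForm (Finsupp.single 0 s - Finsupp.single m (-t)) ω = s * ω 0 + t * ω m := by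
      rw [linForm_sub, linForm, linForm, Finsupp.sum_single_index (by simp),
        Finsupp.sum_single_index (by simp)]
      ring
    rw [seqChar, h1]
  simp only [hlin] at h
  rw [h]
  simp only [covForm_sub_left, covForm_sub_right, covForm_single_single, sub_self, hr0, zero_sub,
    hr, sub_zero]
  congr 2
  ring

lemma zpow_seqShift_apply (m : ℤ) (ω : ℤ → ℝ) (n : ℤ) :
    (seqShift.toEquiv ^ m : Equiv.Perm (ℤ → ℝ)) ω n = ω (n + m) := by
  induction m using Int.induction_on generalizing ω with
  | zero => simp
  | succ k ih =>
    rw [zpow_add_one, Equiv.Perm.mul_apply, ih]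
    change ω (n + k + 1) = _
    rw [add_assoc]
  | pred k ih =>
    rw [zpow_sub_one, Equiv.Perm.mul_apply, ih]
    change ω (n + -k - 1) = _
    rw [add_sub_assoc]

/-- The half-space of sequences with positive zeroth coordinate. -/
def halfSpace : Set (ℤ → ℝ) := {ω | 0 < ω 0}

lemma measurableSet_halfSpace : MeasurableSet halfSpace :=
  measurableSet_lt measurable_const (measurable_pi_apply 0)

lemma real_halfSpace_inter_zpowPreimage
    (hγ : IsGaussianProcess (fun (n : ℤ) (ω : ℤ → ℝ) => ω n) γ)
    (hmean : ∀ n, ∫ ω, ω n ∂γ = 0) (hcov : ∀ m n, ∫ ω, ω m * ω n ∂γ = r (m - n))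
    (hr : ∀ n, r (-n) = r n) (hr0 : r 0 = 1) (m : ℤ) (hm : |r m| ≤ 1) :
    γ.real (halfSpace ∩ zpowPreimage seqShift.toEquiv m halfSpace) =
      (pairLaw (r m)).real quadrant := by
  have hmeas : Measurable fun ω : ℤ → ℝ => (ω 0, ω m) :=
    (measurable_pi_apply 0).prodMk (measurable_pi_apply m)
  rw [← map_pair_eq_pairLaw hγ hmean hcov hr hr0 m hm,
    map_measureReal_apply hmeas measurableSet_quadrant]
  congr 1
  ext ω
  simp [halfSpace, zpowPreimage, quadrant, zpow_seqShift_apply]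

lemma real_halfSpace (hγ : IsGaussianProcess (fun (n : ℤ) (ω : ℤ → ℝ) => ω n) γ)
    (hmean : ∀ n, ∫ ω, ω n ∂γ = 0) (hcov : ∀ m n, ∫ ω, ω m * ω n ∂γ = r (m - n))
    (hr0 : r 0 = 1) : γ.real halfSpace = 1 / 2 := by
  have h0m : Measurable fun ω : ℤ → ℝ => ω 0 := measurable_pi_apply 0
  have hlaw : γ.map (fun ω => ω 0) = gaussianReal 0 1 := by
    rw [(hγ.hasGaussianLaw_eval 0).map_eq_gaussianReal,
      variance_of_integral_eq_zero h0m.aemeasurable (hmean 0), hmean 0]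
    have h1 := hcov 0 0
    simp only [← pow_two, sub_self, hr0] at h1
    rw [h1]; simp
  have h1 : γ.real halfSpace = (gaussianReal 0 1).real (Set.Ioi 0) := by
    rw [← hlaw, map_measureReal_apply h0m measurableSet_Ioi]; rfl
  have h2 : (gaussianReal 0 1).real (Set.Iio 0) = (gaussianReal 0 1).real (Set.Ioi 0) := by
    have h := gaussianReal_map_neg (μ := 0) (v := 1)
    rw [neg_zero] at h
    conv_lhs => rw [← h]
    rw [map_measureReal_apply measurable_neg measurableSet_Iio]
    congr 1; ext x; simp
  have : NullSingletonClass (gaussianReal 0 1) := nullSingletonClass_gaussianReal one_ne_zero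
  have h3 : (gaussianReal 0 1).real (Set.Iic 0) = (gaussianReal 0 1).real (Set.Iio 0) :=
    measureReal_congr Iio_ae_eq_Iic.symm
  have h4 := probReal_compl_eq_one_sub (μ := gaussianReal 0 1) (measurableSet_Iic (a := (0 : ℝ)))
  rw [Set.compl_Iic, h3, h2] at h4
  rw [h1]; linarith

end System

/-! ### The spectral measure and the conclusion -/

namespace FrequencyData

variable {p : Polynomial ℤ} (d : FrequencyData p)

lemma coeff_neg (n : ℤ) : d.coeff (-n) = d.coeff n := by
  unfold coeff
  congr 1; ext ω
  rw [← Real.cos_neg]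
  congr 1; push_cast; ring

lemma coeff_zero : d.coeff 0 = 1 := by simp [coeff]

lemma abs_coeff_le_one (n : ℤ) : |d.coeff n| ≤ 1 := by
  have h := norm_integral_le_of_norm_le_const (μ := stagesMeasure) (C := 1)
    (f := fun ω => Real.cos (2 * Real.pi * (n * d.freq ω)))
    (Eventually.of_forall fun ω => Real.abs_cos_le_one _)
  rwa [probReal_univ, mul_one] at h

/-- The law of the random frequency on the circle. -/
noncomputable def circleLaw : Measure UnitAddCircle :=
  stagesMeasure.map fun ω => (d.freq ω : UnitAddCircle)

lemma measurable_freq_circle : Measurable fun ω => (d.freq ω : UnitAddCircle) :=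
  (AddCircle.continuous_mk' 1).measurable.comp d.measurable_freq

instance : IsProbabilityMeasure d.circleLaw :=
  Measure.isProbabilityMeasure_map d.measurable_freq_circle.aemeasurable

/-- The symmetrized law of the random frequency. Symmetrization makes the Fourier coefficients
real, hence symmetric. -/
noncomputable def spectralMeasure : Measure UnitAddCircle :=
  (2⁻¹ : ℝ≥0∞) • (d.circleLaw + d.circleLaw.map fun x => -x)

instance : IsProbabilityMeasure d.spectralMeasure := by
  have := Measure.isProbabilityMeasure_map (μ := d.circleLaw)
    (measurable_neg (G := UnitAddCircle)).aemeasurable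
  refine ⟨?_⟩
  rw [spectralMeasure, Measure.smul_apply, Measure.add_apply, measure_univ, measure_univ,
    one_add_one_eq_two, smul_eq_mul, ENNReal.inv_mul_cancel two_ne_zero ENNReal.ofNat_ne_top]

lemma fourier_coe_re (n : ℤ) (x : ℝ) :
    (fourier n (x : UnitAddCircle) : ℂ).re = Real.cos (2 * Real.pi * (n * x)) := by
  rw [fourier_coe_apply, ← Complex.exp_ofReal_mul_I_re]
  congr 2
  push_cast
  simp
  ring

lemma integrable_fourier {ν : Measure UnitAddCircle} [IsFiniteMeasure ν] (n : ℤ) :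
    Integrable (fun x : UnitAddCircle => (fourier n x : ℂ)) ν :=
  Integrable.of_bound (fourier n).continuous.aestronglyMeasurable 1
    (Eventually.of_forall fun _ => (Circle.norm_coe _).le)

lemma fourierTransform_spectralMeasure (n : ℤ) :
    fourierTransform d.spectralMeasure n = d.coeff n := by
  have := Measure.isProbabilityMeasure_map (μ := d.circleLaw)
    (measurable_neg (G := UnitAddCircle)).aemeasurable
  have hre : (∫ x : UnitAddCircle, fourier n x ∂d.circleLaw).re = d.coeff n := by
    have hi : Integrable (fun ω => (fourier n (d.freq ω : UnitAddCircle) : ℂ)) stagesMeasure :=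
      (integrable_fourier (ν := d.circleLaw) n).comp_measurable d.measurable_freq_circle
    rw [circleLaw, integral_map d.measurable_freq_circle.aemeasurable
        (fourier n).continuous.aestronglyMeasurable, ← RCLike.re_eq_complex_re, ← integral_re hi]
    refine integral_congr_ae (Eventually.of_forall fun ω => ?_)
    exact fourier_coe_re n _
  rw [fourierTransform, spectralMeasure, integral_smul_measure,
    integral_add_measure (integrable_fourier n) (integrable_fourier n),
    integral_map measurable_neg.aemeasurable (fourier n).continuous.aestronglyMeasurable]
  have hneg : ∀ x : UnitAddCircle, (fourier n (-x) : ℂ) = starRingEnd ℂ (fourier n x) := by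
    intro x
    rw [← fourier_neg]
    simp [fourier_apply]
  simp only [hneg]
  rw [integral_conj, Complex.add_conj, hre]
  simp

/-- The random variable `exp (2 π i n freq)`, as a vector of a real Hilbert space: the inner
products of these vectors are the covariances of the process. -/
noncomputable def expVec (n : ℤ) : Lp ℂ 2 stagesMeasure :=
  (MemLp.of_bound (by have := d.measurable_freq; fun_prop) 1 (Eventually.of_forall fun ω =>
      (Complex.norm_exp_ofReal_mul_I _).le) :
    MemLp (fun ω => Complex.exp (((2 * Real.pi * (n * d.freq ω) : ℝ) : ℂ) * Complex.I)) 2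
      stagesMeasure).toLp

lemma inner_expVec (m n : ℤ) : inner ℝ (d.expVec m) (d.expVec n) = d.coeff (m - n) := by
  rw [L2.inner_def]
  refine integral_congr_ae ?_
  filter_upwards [MemLp.coeFn_toLp (MemLp.of_bound (p := 2) (μ := stagesMeasure)
      (f := fun ω => Complex.exp (((2 * Real.pi * (m * d.freq ω) : ℝ) : ℂ) * Complex.I))
      (by have := d.measurable_freq; fun_prop) 1
      (Eventually.of_forall fun ω => (Complex.norm_exp_ofReal_mul_I _).le)),
    MemLp.coeFn_toLp (MemLp.of_bound (p := 2) (μ := stagesMeasure)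
      (f := fun ω => Complex.exp (((2 * Real.pi * (n * d.freq ω) : ℝ) : ℂ) * Complex.I))
      (by have := d.measurable_freq; fun_prop) 1
      (Eventually.of_forall fun ω => (Complex.norm_exp_ofReal_mul_I _).le))] with ω h1 h2
  rw [expVec, expVec, h1, h2, Complex.inner, ← Complex.exp_conj, ← Complex.exp_add,
    ← Real.cos_neg, ← Complex.exp_ofReal_mul_I_re]
  congr 2
  simp only [map_mul, Complex.conj_ofReal, Complex.conj_I]
  push_cast
  ring

end FrequencyData

theorem mainTheorem4 (p : Polynomial ℤ) (hp0 : p.eval 0 = 0) (hdeg : 1 < p.natDegree) :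
    ∃ (ρ : Measure UnitAddCircle) (γ : Measure (ℤ → ℝ)) (_ : IsProbabilityMeasure γ)
      (hT : MeasurePreserving seqShift γ γ) (A : Set (ℤ → ℝ)),
      IsGaussianSystem ρ γ ∧ IsWeaklyMixing hT ∧ IsRigid hT ∧
      MeasurableSet A ∧ γ.real A = 1 / 2 ∧
      -- the uniform bound along signed finite sums
      (∃ n : (t : ℕ) → Fin t → ℕ, (∀ t s, 0 < n t s) ∧
        ∀ ε : ℝ, 0 < ε → ∃ t₀ : ℕ, ∀ t ≥ t₀, ∀ F : Finset (Fin t), F.Nonempty →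
          ∀ ξ : Fin t → ℤ, (∀ s, ξ s = 1 ∨ ξ s = -1) →
            γ.real (A ∩ zpowPreimage seqShift.toEquiv (p.eval (∑ s ∈ F, ξ s * (n t s : ℤ))) A)
              < 1 / 6 + ε) ∧
      -- the failure of large returns along an IP_0 set
      (∃ δ : ℝ, 0 < δ ∧ ∃ Γ : Set ℕ, IsIP0 Γ ∧ ∀ n ∈ Γ,
        γ.real (A ∩ zpowPreimage seqShift.toEquiv (p.eval (n : ℤ)) A) < γ.real A ^ 2 - δ) := by
  obtain ⟨d⟩ := nonempty_frequencyData p hdeg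
  -- the Gaussian measure with covariance `d.coeff`, and the half-space of positive coordinate zero
  obtain ⟨γ, hprob, hγ, hmean, hcov'⟩ := exists_gaussian_of_inner d.expVec
  have hcov : ∀ m n, ∫ ω, ω m * ω n ∂γ = d.coeff (m - n) := fun m n => by
    rw [hcov', d.inner_expVec]
  have hT := measurePreserving_seqShift hγ hmean hcov
  have hhalf : γ.real halfSpace = 1 / 2 := real_halfSpace hγ hmean hcov d.coeff_zero
  have hsmall : ∀ ε : ℝ, 0 < ε → ∃ t₀ : ℕ, ∀ t ≥ t₀, ∀ F : Finset (Fin t), F.Nonempty →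
      ∀ ξ : Fin t → ℤ, (∀ s, ξ s = 1 ∨ ξ s = -1) →
        γ.real (halfSpace ∩ zpowPreimage seqShift.toEquiv
          (p.eval (∑ s ∈ F, ξ s * (d.n t s : ℤ))) halfSpace) < 1 / 6 + ε := by
    intro ε hε
    obtain ⟨δ, hδ, hquad⟩ := exists_quadrant_lt ε hε
    obtain ⟨t₀, ht₀⟩ := Filter.eventually_atTop.1
      ((FrequencyData.tendsto_const_mul_pow_half (2 * Real.pi * 2)).eventually_lt_const hδ)
    refine ⟨t₀, fun t ht F hF ξ hξ => ?_⟩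
    -- a signed sum over `F` is a full sum with coefficients in `{-1, 0, 1}`, not all zero
    rw [real_halfSpace_inter_zpowPreimage hγ hmean hcov d.coeff_neg d.coeff_zero _
      (d.abs_coeff_le_one _)]
    refine hquad _ (lt_of_le_of_lt ?_ (ht₀ t ht))
    have hsum : ∑ s ∈ F, ξ s * (d.n t s : ℤ)
        = ∑ s, (if s ∈ F then ξ s else 0) * (d.n t s : ℤ) := by
      simp [ite_mul, Finset.sum_ite_mem]
    rw [hsum]
    refine d.abs_coeff_eval_add_half_le hp0 t _ (fun s => ?_) ?_
    · split_ifs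
      · rcases hξ s with h | h <;> simp [h]
      · simp
    · obtain ⟨s, hs⟩ := hF
      refine ⟨s, ?_⟩
      rw [if_pos hs]
      rcases hξ s with h | h <;> simp [h]
  -- for the second part, `1 / 6 + 1 / 24 = (1 / 2) ^ 2 - 1 / 24`
  refine ⟨d.spectralMeasure, γ, hprob, hT, halfSpace, ⟨inferInstance, fun n => ?_, hγ, hmean,
    fun m n => ?_⟩, isWeaklyMixing_of_tendsto_covariance hT hγ hmean hcov d.coeff_neg d.m
      d.tendsto_coeff_m_add, isRigid_of_tendsto_covariance hT hγ hmean hcov d.coeff_neg d.R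
      d.R_mono d.tendsto_coeff_R_add, measurableSet_halfSpace, hhalf,
    ⟨d.n, d.n_pos, hsmall⟩, 1 / 24, by norm_num,
    {n : ℕ | γ.real (halfSpace ∩ zpowPreimage seqShift.toEquiv (p.eval (n : ℤ)) halfSpace)
      < 1 / 6 + 1 / 24}, fun r _ => ?_, fun n hn => ?_⟩
  · rw [d.fourierTransform_spectralMeasure, d.fourierTransform_spectralMeasure, d.coeff_neg]
  · rw [hcov, d.fourierTransform_spectralMeasure]
  -- the first `r` of the integers `n t i` with `t` large, all signs being `1`
  · obtain ⟨t₀, ht₀⟩ := hsmall (1 / 24) (by norm_num)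
    let t := max r t₀
    let ι : Fin r ↪o Fin t := Fin.castLEOrderEmb (le_max_left r t₀)
    refine ⟨fun i => d.n t (ι i), (d.n_strictMono t).comp ι.strictMono, fun i => d.n_pos _ _,
      fun F hF => ?_⟩
    have h := ht₀ t (le_max_right _ _) (F.map ι.toEmbedding) (hF.map) (fun _ => 1)
      (fun _ => Or.inl rfl)
    simp only [Finset.sum_map, one_mul] at h
    rw [Set.mem_ofPred_eq]
    push_cast
    exact h
  · rw [hhalf]
    refine lt_of_lt_of_le hn ?_
    norm_num
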